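/- For a bounded open set $\Omega\subset\mathbb{R}^k$ and $\mu\ge 0$, let $\mathcal{N}_\Omega(\mu)$ be the number, counted with multiplicity, of eigenvalues of the Dirichlet Laplacian $-\Delta$ on $\Omega$ (defined through the weak formulation on $H^1_0(\Omega)$) that are at most $\mu^2$. Let $\omega_k$ be the volume of the unit ball in $\mathbb{R}^k$ and $|\cdot|$ the Lebesgue measure. We say that the Dirichlet Pólya conjecture holds for $\Omega\subset\mathbb{R}^k$ if $$\mathcal{N}_\Omega(\mu)\le \frac{\omega_k}{(2\pi)^k}|\Omega|\mu^k\qquad\text{for all }\mu\ge 0 .$$ **Theorem 3.2.** Let $d\ge 3$, let $\mathscr{D}\subset\mathbb{R}^{d-1}$ be a bounded open set, let $I\subset\mathbb{R}$ be an interval (open, closed or half-open) of finite length $L>0$, and let $\mathcal{C}_d=\mathscr{D}\times I\subset\mathbb{R}^d$. Write $\mathcal{N}_{\mathcal{C}_d}$ for the counting function of the interior of $\mathcal{C}_d$. Suppose that the Dirichlet Pólya conjecture holds for $\mathscr{D}$. Then the following hold for all $\mu\ge 0$. (1) If $d=3$, then $$\mathcal{N}_{\mathcal{C}_3}(\mu)\le\frac{\omega_3}{(2\pi)^3}|\mathcal{C}_3|\mu^3-\frac{\pi|\mathcal{C}_3|}{8L^3}\left\lfloor\frac{L\mu}{\pi}\right\rfloor\left(\left\lfloor\frac{L\mu}{\pi}\right\rfloor+\frac13\right).$$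 (2) If $d\ge 4$, then $$\mathcal{N}_{\mathcal{C}_d}(\mu)\le\frac{\omega_d}{(2\pi)^d}|\mathcal{C}_d|\mu^d-\frac{(d-1)\omega_{d-1}|\mathcal{C}_d|}{4(2\pi)^{d-1}L}\left(\frac{\pi}{L\mu}\left\lfloor\frac{L\mu}{\pi\sqrt{d-2}}\right\rfloor\right)^2\left(1-A_1\left(\frac{\pi}{L\mu}\left\lfloor\frac{L\mu}{\pi\sqrt{d-2}}\right\rfloor\right)^2\right)\mu^{d-1},$$ where $A_1=\frac{d-3}{4}$ if $d\ge 5$ and $A_1=\frac23$ if $d=4$ (for $\mu=0$ the subtracted term is read as $0$). (3) If $d\ge 11$ and $\mu\ge\pi\sqrt{d-2}/L$, then the inequality in (2) still holds when the term $$\frac{\omega_{d-1}|\mathcal{C}_d|}{2(2\pi)^{d-1}L}\left(1-\left(\frac{\pi}{L\mu}\left(\left\lfloor\frac{L\mu}{\pi\sqrt{d-2}}\right\rfloor+2\right)\right)^2\right)^{\frac{d-1}{2}}\mu^{d-1}$$ is subtracted from its right side. -/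

import Mathlib

open MeasureTheory
open scoped ENNReal ContDiff

noncomputable section

/-- `ℝᵏ` with its Euclidean structure. -/
abbrev Rn (k : ℕ) : Type := EuclideanSpace ℝ (Fin k)

/-- Smooth functions on `ℝᵏ` whose support is a compact subset of `Ω`, that is `C_c^∞(Ω)`. -/
def IsTestFunction {k : ℕ} (Ω : Set (Rn k)) (φ : Rn k → ℝ) : Prop :=
  ContDiff ℝ ∞ φ ∧ HasCompactSupport φ ∧ tsupport φ ⊆ Ω

/-- The (real) Hilbert space `L²(Ω)`. -/
abbrev L2Fun {k : ℕ} (Ω : Set (Rn k)) : Type := Lp ℝ 2 (volume.restrict Ω)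

/-- The Hilbert space `L²(Ω; ℝᵏ)` of square integrable vector fields. -/
abbrev L2Field {k : ℕ} (Ω : Set (Rn k)) : Type := Lp (Rn k) 2 (volume.restrict Ω)

/-- The pairs `(φ, ∇φ)` with `φ ∈ C_c^∞(Ω)`, as a subspace of `L²(Ω) × L²(Ω; ℝᵏ)`. -/
def testGraph {k : ℕ} (Ω : Set (Rn k)) : Submodule ℝ (L2Fun Ω × L2Field Ω) where
  carrier := {p | ∃ φ : Rn k → ℝ, IsTestFunction Ω φ ∧
    p.1 =ᵐ[volume.restrict Ω] φ ∧ p.2 =ᵐ[volume.restrict Ω] gradient φ}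
  zero_mem' := by
    refine ⟨fun _ => 0, ⟨contDiff_const, ?_, ?_⟩, ?_, ?_⟩
    · simp [HasCompactSupport, tsupport, Function.support]
    · simp [tsupport, Function.support]
    · exact Lp.coeFn_zero _ _ _
    · refine (Lp.coeFn_zero _ _ _).trans (Filter.Eventually.of_forall fun x => ?_)
      simp [gradient]
  add_mem' := by
    rintro p q ⟨φ, ⟨hφ1, hφ2, hφ3⟩, hφ4, hφ5⟩ ⟨ψ, ⟨hψ1, hψ2, hψ3⟩, hψ4, hψ5⟩
    refine ⟨φ + ψ, ⟨hφ1.add hψ1, hφ2.add hψ2, ?_⟩, ?_, ?_⟩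
    · exact (tsupport_add φ ψ).trans (Set.union_subset hφ3 hψ3)
    · exact (Lp.coeFn_add _ _).trans (hφ4.add hψ4)
    · refine (Lp.coeFn_add _ _).trans ((hφ5.add hψ5).trans
        (Filter.Eventually.of_forall fun x => ?_))
      have h1 : DifferentiableAt ℝ φ x := (hφ1.differentiable (by simp)) x
      have h2 : DifferentiableAt ℝ ψ x := (hψ1.differentiable (by simp)) x
      simp [gradient, fderiv_add h1 h2]
  smul_mem' := by
    rintro c p ⟨φ, ⟨hφ1, hφ2, hφ3⟩, hφ4, hφ5⟩
    refine ⟨c • φ, ⟨contDiff_const.smul hφ1, hφ2.smul_left (f := fun _ => c), ?_⟩, ?_, ?_⟩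
    · exact (closure_mono (Function.support_const_smul_subset c φ)).trans hφ3
    · exact (Lp.coeFn_smul _ _).trans (hφ4.const_smul c)
    · refine (Lp.coeFn_smul _ _).trans ((hφ5.const_smul c).trans
        (Filter.Eventually.of_forall fun x => ?_))
      have h1 : DifferentiableAt ℝ φ x := (hφ1.differentiable (by simp)) x
      simp [gradient, fderiv_const_smul h1]

/-- The Sobolev space `H¹₀(Ω)`, the closure of `C_c^∞(Ω)` for the `H¹`-norm. An element `u` is
recorded together with its weak gradient, as the pair `(u, ∇u)` in `L²(Ω) × L²(Ω; ℝᵏ)`. -/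
def H10 {k : ℕ} (Ω : Set (Rn k)) : Submodule ℝ (L2Fun Ω × L2Field Ω) :=
  (testGraph Ω).topologicalClosure

/-- The eigenspace of the Dirichlet Laplacian `-Δ` on the open set `Ω` for the number `lam`:
all `u ∈ H¹₀(Ω)` with `∫_Ω ∇u · ∇v = lam ∫_Ω u v` for every `v ∈ H¹₀(Ω)`
(it is `0` if `lam` is not an eigenvalue). -/
def dirichletEigenspace {k : ℕ} (Ω : Set (Rn k)) (lam : ℝ) : Submodule ℝ (L2Fun Ω) where
  carrier := {u | ∃ G : L2Field Ω, (u, G) ∈ H10 Ω ∧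
    ∀ (v : L2Fun Ω) (H : L2Field Ω), (v, H) ∈ H10 Ω →
      inner ℝ G H = lam * inner ℝ u v}
  zero_mem' := ⟨0, (H10 Ω).zero_mem, fun v H _ => by simp⟩
  add_mem' := by
    rintro u w ⟨G, hG, hu⟩ ⟨K, hK, hw⟩
    refine ⟨G + K, (H10 Ω).add_mem hG hK, fun v H hv => ?_⟩
    rw [inner_add_left, inner_add_left, hu v H hv, hw v H hv, mul_add]
  smul_mem' := by
    rintro c u ⟨G, hG, hu⟩
    refine ⟨c • G, (H10 Ω).smul_mem c hG, fun v H hv => ?_⟩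
    rw [real_inner_smul_left, real_inner_smul_left, hu v H hv]
    ring

/-- The Dirichlet eigenvalue counting function of the open set `Ω`: the number, counted with
multiplicity, of Dirichlet eigenvalues of `-Δ` on `Ω` that are at most `μ²`. -/
def dirichletCount {k : ℕ} (Ω : Set (Rn k)) (μ : ℝ) : ℝ≥0∞ :=
  ∑' lam : Set.Iic (μ ^ 2),
    ((Cardinal.toENat (Module.rank ℝ (dirichletEigenspace Ω (lam : ℝ))) : ℕ∞) : ℝ≥0∞)

/-- The volume `ω_k` of the unit ball in `ℝᵏ`. -/
def unitBallVolume (k : ℕ) : ℝ := volume.real (Metric.ball (0 : Rn k) 1)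

/-- The Dirichlet Pólya conjecture holds for `Ω ⊂ ℝᵏ`. -/
def DirichletPolya {k : ℕ} (Ω : Set (Rn k)) : Prop :=
  ∀ μ : ℝ, 0 ≤ μ →
    (dirichletCount Ω μ : EReal) ≤
      ((unitBallVolume k / (2 * Real.pi) ^ k * volume.real Ω * μ ^ k : ℝ) : EReal)

/-- The product `D × I ⊂ ℝⁿ × ℝ = ℝⁿ⁺¹`. -/
def productDomain {n : ℕ} (D : Set (Rn n)) (I : Set ℝ) : Set (Rn (n + 1)) :=
  {x | WithLp.toLp 2 (fun i : Fin n => x i.castSucc) ∈ D ∧ x (Fin.last n) ∈ I}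

/-- The constant `A₁` (used for `d ≥ 4`). -/
def constA₁ (d : ℕ) : ℝ := if 5 ≤ d then ((d : ℝ) - 3) / 4 else 2 / 3

/-- The right side of the improved bound for `d = 3`, where `V = |D × I|`. -/
def boundThree (V L μ : ℝ) : ℝ :=
  unitBallVolume 3 / (2 * Real.pi) ^ 3 * V * μ ^ 3
    - Real.pi * V / (8 * L ^ 3) * (⌊L * μ / Real.pi⌋ : ℝ) * ((⌊L * μ / Real.pi⌋ : ℝ) + 1 / 3)

/-- The integer `⌊L μ / (π √(d - 2))⌋`. -/
def floorSigma (d : ℕ) (L μ : ℝ) : ℤ := ⌊L * μ / (Real.pi * √((d : ℝ) - 2))⌋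

/-- The right side of the improved bound for `d ≥ 4`, where `V = |D × I|`. -/
def boundHigh (d : ℕ) (V L μ : ℝ) : ℝ :=
  unitBallVolume d / (2 * Real.pi) ^ d * V * μ ^ d
    - ((d : ℝ) - 1) * unitBallVolume (d - 1) * V / (4 * (2 * Real.pi) ^ (d - 1) * L)
      * (Real.pi / (L * μ) * (floorSigma d L μ : ℝ)) ^ 2
      * (1 - constA₁ d * (Real.pi / (L * μ) * (floorSigma d L μ : ℝ)) ^ 2)
      * μ ^ (d - 1)

/-- The term that is subtracted in addition for `d ≥ 11`, where `V = |D × I|`. -/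
def extraTerm (d : ℕ) (V L μ : ℝ) : ℝ :=
  unitBallVolume (d - 1) * V / (2 * (2 * Real.pi) ^ (d - 1) * L)
    * (1 - (Real.pi / (L * μ) * ((floorSigma d L μ : ℝ) + 2)) ^ 2) ^ (((d : ℝ) - 1) / 2)
    * μ ^ (d - 1)

end

open Set Filter Topology
open scoped BoundedContinuousFunction

noncomputable section

/-! ### The splitting `ℝⁿ⁺¹ = ℝⁿ × ℝ` -/

/-! Write n = d - 1. Separation of variables suggests that the eigenvalues of D × (a, a + L) are the
sums of an eigenvalue of D and (πl/L)² with l ≥ 1. Only an upper bound for the count is needed, so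
no spectral theorem enters. The partial sine coefficients u ↦ ∫ u(y,t) sin(πl(t - a)/L) dt map the
eigenspace of the product for λ into the eigenspace of D for λ - (πl/L)²
(`adjoint_tensorLast_mem_dirichletEigenspace`), and together they are injective because the sines
are complete (`eq_zero_of_adjoint_tensorLast_eq_zero`). Pólya's inequality at μ = 0 shows that D has
no eigenvalue ≤ 0, so only finitely many l contribute. Comparing ranks and summing over λ bounds the
count by Σ N_D(√(μ² - (πl/L)²)) over 1 ≤ l ≤ Lμ/π (`dirichletCount_product_le`).

Pólya's inequality for D turns this into a constant times Σ f(l), where f(s) = (R² - s²)₊^(n/2) and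
R = Lμ/π. Slicing a ball shows that the same constant times ∫₀^∞ f is exactly the Weyl term of the
product (`weyl_term_eq`). What remains is to measure how far the sum falls below the integral.

For n = 2 the sum is explicit and the deficit is a positive multiple of (R - m)²(2R + m), with m =
⌊R⌋. For n ≥ 3 the profile f is concave up to R/√(n - 1) and convex from there to R. With σ = ⌊R/√(n
- 1)⌋, the trapezoidal rule on [0, σ] gains (f(0) - f(σ))/2, which a Taylor-type bound makes
explicit. The midpoint rule beyond the inflection gains a further f(σ + 2)/2; d ≥ 11 guarantees σ +
2 ≤ R. -/

/-- The projection `ℝⁿ⁺¹ → ℝⁿ` that forgets the last coordinate. -/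
def dropLast (n : ℕ) : Rn (n + 1) →L[ℝ] Rn n :=
  LinearMap.toContinuousLinearMap
    { toFun := fun x => WithLp.toLp 2 (fun i : Fin n => x i.castSucc)
      map_add' := fun _ _ => rfl
      map_smul' := fun _ _ => rfl }

/-- The last coordinate on `ℝⁿ⁺¹`. -/
def lastCoord (n : ℕ) : Rn (n + 1) →L[ℝ] ℝ := EuclideanSpace.proj (Fin.last n)

/-- The embedding `y ↦ (y, 0)` of `ℝⁿ` into `ℝⁿ⁺¹`. -/
def snocZero (n : ℕ) : Rn n →L[ℝ] Rn (n + 1) :=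
  LinearMap.toContinuousLinearMap
    { toFun := fun y => WithLp.toLp 2 (Fin.snoc (α := fun _ => ℝ) (fun i => y i) 0)
      map_add' := fun x y => by
        ext i; refine Fin.lastCases ?_ (fun j => ?_) i <;> simp
      map_smul' := fun c y => by
        ext i; refine Fin.lastCases ?_ (fun j => ?_) i <;> simp }

/-- The last vector of the standard basis of `ℝⁿ⁺¹`. -/
def lastVec (n : ℕ) : Rn (n + 1) := EuclideanSpace.single (Fin.last n) 1

/-- The point `(y, t)` of `ℝⁿ⁺¹`. -/
def joinLast {n : ℕ} (y : Rn n) (t : ℝ) : Rn (n + 1) := snocZero n y + t • lastVec n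

@[simp] lemma dropLast_apply {n : ℕ} (x : Rn (n + 1)) (i : Fin n) :
    dropLast n x i = x i.castSucc := rfl

@[simp] lemma lastCoord_apply {n : ℕ} (x : Rn (n + 1)) : lastCoord n x = x (Fin.last n) := rfl

@[simp] lemma snocZero_castSucc {n : ℕ} (y : Rn n) (i : Fin n) :
    snocZero n y i.castSucc = y i := by simp [snocZero]

@[simp] lemma snocZero_last {n : ℕ} (y : Rn n) : snocZero n y (Fin.last n) = 0 := by
  simp [snocZero]

@[simp] lemma dropLast_snocZero {n : ℕ} (y : Rn n) : dropLast n (snocZero n y) = y := by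
  ext i; simp

@[simp] lemma dropLast_lastVec (n : ℕ) : dropLast n (lastVec n) = 0 := by
  ext i; simp [lastVec, Fin.castSucc_ne_last]

@[simp] lemma lastVec_last (n : ℕ) : lastVec n (Fin.last n) = 1 := by simp [lastVec]

@[simp] lemma dropLast_joinLast {n : ℕ} (y : Rn n) (t : ℝ) : dropLast n (joinLast y t) = y := by
  simp [joinLast]

@[simp] lemma joinLast_last {n : ℕ} (y : Rn n) (t : ℝ) : joinLast y t (Fin.last n) = t := by
  simp [joinLast]

lemma lastVec_castSucc {n : ℕ} (i : Fin n) : lastVec n i.castSucc = 0 := by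
  simp [lastVec, Fin.castSucc_ne_last]

@[simp] lemma joinLast_dropLast {n : ℕ} (x : Rn (n + 1)) :
    joinLast (dropLast n x) (x (Fin.last n)) = x := by
  ext i
  refine Fin.lastCases ?_ (fun j => ?_) i
  · simp
  · simp [joinLast, lastVec_castSucc]

lemma inner_snocZero {n : ℕ} (x : Rn (n + 1)) (y : Rn n) :
    inner ℝ x (snocZero n y) = inner ℝ (dropLast n x) y := by
  simp [PiLp.inner_apply, Fin.sum_univ_castSucc]

lemma inner_lastVec {n : ℕ} (x : Rn (n + 1)) :
    inner ℝ x (lastVec n) = x (Fin.last n) := by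
  simp [lastVec, EuclideanSpace.inner_single_right]

lemma adjoint_snocZero (n : ℕ) : ContinuousLinearMap.adjoint (snocZero n) = dropLast n := by
  symm
  rw [ContinuousLinearMap.eq_adjoint_iff]
  intro x y
  rw [inner_snocZero]

lemma continuous_joinLast {n : ℕ} : Continuous fun p : Rn n × ℝ => joinLast p.1 p.2 := by
  unfold joinLast; fun_prop

/-- The splitting of `ℝⁿ⁺¹` as `ℝⁿ × ℝ`. -/
def splitLast (n : ℕ) : Rn (n + 1) ≃ᵐ Rn n × ℝ where
  toFun x := (dropLast n x, x (Fin.last n))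
  invFun p := joinLast p.1 p.2
  left_inv x := by simp
  right_inv p := by simp
  measurable_toFun := by
    apply Continuous.measurable
    exact (dropLast n).continuous.prodMk (lastCoord n).continuous
  measurable_invFun := continuous_joinLast.measurable

@[simp] lemma splitLast_apply {n : ℕ} (x : Rn (n + 1)) :
    splitLast n x = (dropLast n x, x (Fin.last n)) := rfl

@[simp] lemma splitLast_symm_apply {n : ℕ} (p : Rn n × ℝ) :
    (splitLast n).symm p = joinLast p.1 p.2 := rfl

lemma volume_preserving_splitLast (n : ℕ) : MeasurePreserving (splitLast n) := by
  have h1 : MeasurePreserving (WithLp.ofLp : Rn (n + 1) → (Fin (n + 1) → ℝ)) :=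
    PiLp.volume_preserving_ofLp _
  have h2 := volume_preserving_piFinSuccAbove (fun _ : Fin (n + 1) => ℝ) (Fin.last n)
  have h3 : MeasurePreserving (Prod.swap : ℝ × (Fin n → ℝ) → (Fin n → ℝ) × ℝ)
      (volume.prod volume) (volume.prod volume) := Measure.measurePreserving_swap
  have h4 : MeasurePreserving
      (Prod.map (WithLp.toLp 2) id : (Fin n → ℝ) × ℝ → Rn n × ℝ)
      (volume.prod volume) (volume.prod volume) :=
    (PiLp.volume_preserving_toLp (Fin n)).prod (MeasurePreserving.id volume)
  have h := h4.comp (h3.comp (h2.comp h1))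
  have he : ⇑(splitLast n) = Prod.map (WithLp.toLp 2) id ∘ Prod.swap ∘
      MeasurableEquiv.piFinSuccAbove (fun _ : Fin (n + 1) => ℝ) (Fin.last n) ∘ WithLp.ofLp := by
    ext x
    · simp [MeasurableEquiv.piFinSuccAbove, Fin.init]
    · simp [MeasurableEquiv.piFinSuccAbove]
  rw [he]
  exact h

lemma mem_productDomain {n : ℕ} {D : Set (Rn n)} {I : Set ℝ} {x : Rn (n + 1)} :
    x ∈ productDomain D I ↔ dropLast n x ∈ D ∧ x (Fin.last n) ∈ I := Iff.rfl

lemma productDomain_eq_preimage {n : ℕ} (D : Set (Rn n)) (I : Set ℝ) :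
    productDomain D I = splitLast n ⁻¹' (D ×ˢ I) := by
  ext x; rfl

lemma isOpen_productDomain {n : ℕ} {D : Set (Rn n)} {I : Set ℝ} (hD : IsOpen D) (hI : IsOpen I) :
    IsOpen (productDomain D I) :=
  (hD.preimage (dropLast n).continuous).inter (hI.preimage (lastCoord n).continuous)

lemma isCompact_productDomain {n : ℕ} {D : Set (Rn n)} {I : Set ℝ} (hD : IsCompact D)
    (hI : IsCompact I) : IsCompact (productDomain D I) := by
  have := (hD.prod hI).image (continuous_joinLast (n := n))
  convert this
  ext x
  constructor
  · intro hx
    exact ⟨(dropLast n x, x (Fin.last n)), ⟨hx.1, hx.2⟩, by simp⟩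
  · rintro ⟨p, hp, rfl⟩
    rw [mem_productDomain]
    exact ⟨by simpa using hp.1, by simpa using hp.2⟩

/-- A vertical line meets the interior in an open subset of [a, b], hence inside (a, b). This
reduces every kind of interval to the open one. -/
lemma interior_productDomain {n : ℕ} {D : Set (Rn n)} (hD : IsOpen D) {a b : ℝ} {I : Set ℝ}
    (h1 : Ioo a b ⊆ I) (h2 : I ⊆ Icc a b) :
    interior (productDomain D I) = productDomain D (Ioo a b) := by
  apply Subset.antisymm
  · intro x hx
    refine ⟨(interior_subset hx).1, ?_⟩
    have hc : Continuous fun t : ℝ => joinLast (dropLast n x) t :=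
      continuous_joinLast.comp (continuous_const.prodMk continuous_id)
    have ho := (isOpen_interior (s := productDomain D I)).preimage hc
    have hs : (fun t : ℝ => joinLast (dropLast n x) t) ⁻¹' interior (productDomain D I)
        ⊆ Icc a b := fun t ht => by
      have := (mem_productDomain.1 (interior_subset ht)).2
      exact h2 (by simpa using this)
    have := ho.subset_interior_iff.2 hs
    rw [interior_Icc] at this
    exact this (by simpa using hx)
  · exact (isOpen_productDomain hD isOpen_Ioo).subset_interior_iff.2
      (fun x hx => ⟨hx.1, h1 hx.2⟩)

lemma measurePreserving_splitLast_restrict {n : ℕ} (D : Set (Rn n)) (I : Set ℝ) :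
    MeasurePreserving (splitLast n) (volume.restrict (productDomain D I))
      ((volume.restrict D).prod (volume.restrict I)) := by
  have := (volume_preserving_splitLast n).restrict_preimage_emb
    (splitLast n).measurableEmbedding (D ×ˢ I)
  rw [Measure.prod_restrict]
  exact this

lemma volume_productDomain {n : ℕ} (D : Set (Rn n)) (I : Set ℝ) :
    volume (productDomain D I) = volume D * volume I := by
  rw [productDomain_eq_preimage, (volume_preserving_splitLast n).measure_preimage_equiv,
    Measure.volume_eq_prod, Measure.prod_prod]

lemma volume_real_productDomain {n : ℕ} (D : Set (Rn n)) {a L : ℝ} (hL : 0 < L) {I : Set ℝ}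
    (h1 : Ioo a (a + L) ⊆ I) (h2 : I ⊆ Icc a (a + L)) :
    volume.real (productDomain D I) = volume.real D * L := by
  have hI : volume I = ENNReal.ofReal L := by
    apply le_antisymm
    · simpa using measure_mono (μ := volume) h2
    · simpa using measure_mono (μ := volume) h1
  simp [Measure.real, volume_productDomain, hI, hL.le]

/-! ### Multiplication by a function of the last coordinate -/

section TensorLast

variable {n : ℕ} {E F : Type*} [NormedAddCommGroup E] [NormedAddCommGroup F]

/-- All fibres over D have the same length |J|. Composition with `dropLast` therefore respects
almost everywhere equality, and it is bounded on L² when |J| is finite. -/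
lemma map_dropLast_restrict (D : Set (Rn n)) (J : Set ℝ) :
    Measure.map (dropLast n) (volume.restrict (productDomain D J)) =
      volume J • volume.restrict D := by
  have h := (measurePreserving_splitLast_restrict D J).map_eq
  have : ⇑(dropLast n) = Prod.fst ∘ splitLast n := rfl
  rw [this, ← Measure.map_map measurable_fst (splitLast n).measurable, h, Measure.map_fst_prod]
  simp

lemma quasiMeasurePreserving_dropLast {D : Set (Rn n)} {J : Set ℝ} :
    Measure.QuasiMeasurePreserving (dropLast n) (volume.restrict (productDomain D J))
      (volume.restrict D) := by
  refine ⟨(dropLast n).continuous.measurable, ?_⟩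
  rw [map_dropLast_restrict]
  exact Measure.smul_absolutelyContinuous

lemma memLp_comp_dropLast {D : Set (Rn n)} {J : Set ℝ} (hJ : volume J ≠ ⊤) {f : Rn n → E}
    (hf : MemLp f 2 (volume.restrict D)) :
    MemLp (fun x => f (dropLast n x)) 2 (volume.restrict (productDomain D J)) := by
  have h := hf.smul_measure hJ
  rw [← map_dropLast_restrict] at h
  exact h.comp_of_map (dropLast n).continuous.measurable.aemeasurable

lemma eLpNorm_comp_dropLast {D : Set (Rn n)} {J : Set ℝ} (hJ : volume J ≠ ⊤) {f : Rn n → E}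
    (hf : MemLp f 2 (volume.restrict D)) :
    eLpNorm (fun x => f (dropLast n x)) 2 (volume.restrict (productDomain D J)) =
      volume J ^ (1 / (2 : ℝ)) * eLpNorm f 2 (volume.restrict D) := by
  have h := hf.smul_measure hJ
  have h2 := eLpNorm_smul_measure_of_ne_top (p := 2) (by simp) f (volume J)
    (μ := volume.restrict D)
  rw [← map_dropLast_restrict] at h h2
  rw [eLpNorm_map_measure h.1 (dropLast n).continuous.measurable.aemeasurable] at h2
  simpa [Function.comp_def] using h2

variable [InnerProductSpace ℝ E] [InnerProductSpace ℝ F]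

lemma norm_tensorLast_le (c : ℝ →ᵇ ℝ) (A : E →L[ℝ] F) (t : ℝ) (e : E) :
    ‖c t • A e‖ ≤ (‖c‖ * ‖A‖) * ‖e‖ := by
  rw [norm_smul, mul_assoc]
  gcongr
  · exact c.norm_coe_le_norm t
  · exact A.le_opNorm e

lemma memLp_tensorLast {D : Set (Rn n)} {J : Set ℝ} (hJ : volume J ≠ ⊤) (c : ℝ →ᵇ ℝ)
    (A : E →L[ℝ] F) {f : Rn n → E} (hf : MemLp f 2 (volume.restrict D)) :
    MemLp (fun x => c (x (Fin.last n)) • A (f (dropLast n x))) 2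
      (volume.restrict (productDomain D J)) := by
  have h := memLp_comp_dropLast hJ hf
  refine h.of_le_mul (c := ‖c‖ * ‖A‖) ?_ (Eventually.of_forall fun x => ?_)
  · exact ((c.continuous.comp (lastCoord n).continuous).aestronglyMeasurable).smul
      (A.continuous.comp_aestronglyMeasurable h.1)
  · exact norm_tensorLast_le c A _ _

/-- The bounded operator `f ↦ c(t) A f(y)` from `L²(D; E)` to `L²(D × J; F)`. -/
def tensorLast (D : Set (Rn n)) {J : Set ℝ} (hJ : volume J ≠ ⊤) (c : ℝ →ᵇ ℝ) (A : E →L[ℝ] F) :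
    Lp E 2 (volume.restrict D) →L[ℝ] Lp F 2 (volume.restrict (productDomain D J)) :=
  LinearMap.mkContinuous
    { toFun := fun f => (memLp_tensorLast hJ c A (Lp.memLp f)).toLp _
      map_add' := fun f g => by
        rw [← MemLp.toLp_add]
        apply MemLp.toLp_congr
        filter_upwards [quasiMeasurePreserving_dropLast.ae (Lp.coeFn_add f g)] with x hx
        simp only [hx, Pi.add_apply, map_add, smul_add]
      map_smul' := fun r f => by
        rw [RingHom.id_apply, ← MemLp.toLp_const_smul]
        apply MemLp.toLp_congr
        filter_upwards [quasiMeasurePreserving_dropLast.ae (Lp.coeFn_smul r f)] with x hx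
        simp only [hx, Pi.smul_apply, map_smul]
        rw [smul_comm] }
    ((‖c‖ * ‖A‖) * (volume J ^ (1 / (2 : ℝ))).toReal) (fun f => by
      simp only [LinearMap.coe_mk, AddHom.coe_mk, Lp.norm_toLp]
      have h1 := eLpNorm_le_mul_eLpNorm_of_ae_le_mul
        (f := fun x => c (x (Fin.last n)) • A (f (dropLast n x)))
        (g := fun x => f (dropLast n x)) (μ := volume.restrict (productDomain D J))
        (Eventually.of_forall fun x => norm_tensorLast_le c A _ _) 2
      rw [eLpNorm_comp_dropLast hJ (Lp.memLp f)] at h1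
      have hfin : volume J ^ (1 / (2 : ℝ)) ≠ ⊤ := ENNReal.rpow_ne_top_of_nonneg (by norm_num) hJ
      have h2 := ENNReal.toReal_mono (by
        refine ENNReal.mul_ne_top ENNReal.ofReal_ne_top
          (ENNReal.mul_ne_top hfin (Lp.memLp f).2.ne)) h1
      rw [ENNReal.toReal_mul, ENNReal.toReal_mul, ENNReal.toReal_ofReal (by positivity)] at h2
      rw [Lp.norm_def]
      linarith)

lemma coeFn_tensorLast (D : Set (Rn n)) {J : Set ℝ} (hJ : volume J ≠ ⊤) (c : ℝ →ᵇ ℝ)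
    (A : E →L[ℝ] F) (f : Lp E 2 (volume.restrict D)) :
    tensorLast D hJ c A f =ᵐ[volume.restrict (productDomain D J)]
      fun x => c (x (Fin.last n)) • A (f (dropLast n x)) :=
  MemLp.coeFn_toLp (memLp_tensorLast hJ c A (Lp.memLp f))

lemma coeFn_tensorLast_of_ae {D : Set (Rn n)} {J : Set ℝ} (hJ : volume J ≠ ⊤) (c : ℝ →ᵇ ℝ)
    (A : E →L[ℝ] F) {f : Lp E 2 (volume.restrict D)} {g : Rn n → E}
    (hg : f =ᵐ[volume.restrict D] g) :
    tensorLast D hJ c A f =ᵐ[volume.restrict (productDomain D J)]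
      fun x => c (x (Fin.last n)) • A (g (dropLast n x)) := by
  filter_upwards [coeFn_tensorLast D hJ c A f, quasiMeasurePreserving_dropLast.ae hg] with x h1 h2
  rw [h1, h2]

/-- The adjoint of `tensorLast` integrates over the last variable. -/
lemma coeFn_adjoint_tensorLast [CompleteSpace E] [CompleteSpace F] {D : Set (Rn n)} {J : Set ℝ}
    (hJ : volume J ≠ ⊤) (c : ℝ →ᵇ ℝ) (A : E →L[ℝ] F)
    (w : Lp F 2 (volume.restrict (productDomain D J))) {W : Rn (n + 1) → F}
    (hw : w =ᵐ[volume.restrict (productDomain D J)] W) {V : Rn n → E}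
    (hV : MemLp V 2 (volume.restrict D))
    (hVW : ∀ y ∈ D, V y = ∫ t in J, c t • ContinuousLinearMap.adjoint A (W (joinLast y t)))
    (hint : ∀ y ∈ D, IntegrableOn (fun t => W (joinLast y t)) J) (hD : MeasurableSet D) :
    ContinuousLinearMap.adjoint (tensorLast D hJ c A) w =ᵐ[volume.restrict D] V := by
  refine Filter.EventuallyEq.trans ?_ (MemLp.coeFn_toLp hV)
  suffices h : ContinuousLinearMap.adjoint (tensorLast D hJ c A) w = hV.toLp V by rw [h]
  refine ext_inner_right ℝ fun f => ?_
  rw [ContinuousLinearMap.adjoint_inner_left]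
  have hi := L2.integrable_inner (𝕜 := ℝ) w (tensorLast D hJ c A f)
  rw [L2.inner_def, L2.inner_def]
  have hae : (fun x => inner ℝ (w x) (tensorLast D hJ c A f x))
      =ᵐ[volume.restrict (productDomain D J)]
      (fun p : Rn n × ℝ => inner ℝ (W (joinLast p.1 p.2)) (c p.2 • A (f p.1))) ∘ splitLast n := by
    filter_upwards [hw, coeFn_tensorLast D hJ c A f] with x h1 h2
    simp [h1, h2]
  have hmp := measurePreserving_splitLast_restrict D J
  have hi2 := (hmp.integrable_comp_emb (splitLast n).measurableEmbedding).1 (hi.congr hae)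
  rw [integral_congr_ae hae]
  refine (hmp.integral_comp (splitLast n).measurableEmbedding
    (fun p : Rn n × ℝ => inner ℝ (W (joinLast p.1 p.2)) (c p.2 • A (f p.1)))).trans ?_
  rw [integral_prod _ hi2]
  apply integral_congr_ae
  filter_upwards [MemLp.coeFn_toLp hV, ae_restrict_mem hD] with y h1 h2
  rw [h1, hVW y h2]
  have hI : IntegrableOn (fun t => c t • ContinuousLinearMap.adjoint A (W (joinLast y t))) J :=
    ((ContinuousLinearMap.adjoint A).integrable_comp (hint y h2)).bdd_smul ‖c‖
      c.continuous.aestronglyMeasurable (Eventually.of_forall fun t => c.norm_coe_le_norm t)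
  rw [real_inner_comm, ← integral_inner hI]
  refine integral_congr_ae (Eventually.of_forall fun t => ?_)
  simp only [real_inner_smul_right, ContinuousLinearMap.adjoint_inner_right]
  rw [real_inner_comm]

end TensorLast

/-! ### Test functions -/

section TestFunctions

variable {k n : ℕ}

lemma IsTestFunction.gradient_continuous {Ω : Set (Rn k)} {φ : Rn k → ℝ}
    (h : IsTestFunction Ω φ) : Continuous (gradient φ) :=
  (InnerProductSpace.toDual ℝ (Rn k)).symm.continuous.comp (h.1.continuous_fderiv (by simp))

lemma tsupport_gradient_subset (φ : Rn k → ℝ) : tsupport (gradient φ) ⊆ tsupport φ := by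
  refine Subset.trans (closure_mono ?_) (tsupport_fderiv_subset ℝ (f := φ))
  intro x hx
  rw [Function.mem_support] at hx ⊢
  contrapose! hx
  simp [gradient, hx]

lemma IsTestFunction.gradient_hasCompactSupport {Ω : Set (Rn k)} {φ : Rn k → ℝ}
    (h : IsTestFunction Ω φ) : HasCompactSupport (gradient φ) :=
  h.2.1.mono' ((subset_tsupport _).trans (tsupport_gradient_subset φ))

lemma IsTestFunction.memLp {Ω : Set (Rn k)} {φ : Rn k → ℝ} (h : IsTestFunction Ω φ) :
    MemLp φ 2 (volume.restrict Ω) :=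
  h.1.continuous.memLp_of_hasCompactSupport h.2.1

lemma IsTestFunction.memLp_gradient {Ω : Set (Rn k)} {φ : Rn k → ℝ} (h : IsTestFunction Ω φ) :
    MemLp (gradient φ) 2 (volume.restrict Ω) :=
  h.gradient_continuous.memLp_of_hasCompactSupport h.gradient_hasCompactSupport

lemma IsTestFunction.mem_H10 {Ω : Set (Rn k)} {φ : Rn k → ℝ} (h : IsTestFunction Ω φ)
    {u : L2Fun Ω} {G : L2Field Ω} (hu : u =ᵐ[volume.restrict Ω] φ)
    (hG : G =ᵐ[volume.restrict Ω] gradient φ) : (u, G) ∈ H10 Ω :=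
  Submodule.le_topologicalClosure _ ⟨φ, h, hu, hG⟩

lemma inner_gradient {φ : Rn k → ℝ} (x v : Rn k) :
    inner ℝ (gradient φ x) v = fderiv ℝ φ x v := by
  simp [gradient]

/-- A closed relation that holds for test functions holds on `H¹₀`. -/
lemma mem_of_mem_H10 {Ω : Set (Rn k)} {S : Set (L2Fun Ω × L2Field Ω)} (hS : IsClosed S)
    (h : ∀ p ∈ testGraph Ω, p ∈ S) {p : L2Fun Ω × L2Field Ω} (hp : p ∈ H10 Ω) : p ∈ S :=
  hS.closure_subset_iff.2 h hp

variable {F : Type*} [NormedAddCommGroup F]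

/-! ### Integrating test functions over the last variable -/

lemma hasCompactSupport_comp_joinLast {W : Rn (n + 1) → F} (hW : HasCompactSupport W) (y : Rn n) :
    HasCompactSupport fun t => W (joinLast y t) := by
  refine HasCompactSupport.intro (hW.isCompact.image (lastCoord n).continuous) fun t ht => ?_
  by_contra h
  exact ht ⟨joinLast y t, subset_tsupport _ h, by simp⟩

lemma continuous_comp_joinLast {W : Rn (n + 1) → F} (hW : Continuous W) (y : Rn n) :
    Continuous fun t => W (joinLast y t) :=
  hW.comp (continuous_joinLast.comp (continuous_const.prodMk continuous_id))

variable [NormedSpace ℝ F]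

lemma hasFDerivAt_comp_joinLast {W : Rn (n + 1) → F} (hW : Differentiable ℝ W) (y : Rn n) (t : ℝ) :
    HasFDerivAt (fun z => W (joinLast z t)) ((fderiv ℝ W (joinLast y t)).comp (snocZero n)) y := by
  have h : HasFDerivAt (fun z => joinLast z t) (snocZero n) y := by
    unfold joinLast
    exact (snocZero n).hasFDerivAt.add_const _
  exact (hW _).hasFDerivAt.comp y h

lemma hasFDerivAt_integral_joinLast {W : Rn (n + 1) → F} (hW : ContDiff ℝ 1 W)
    (hc : HasCompactSupport W) (y : Rn n) :
    HasFDerivAt (fun z => ∫ t, W (joinLast z t))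
      (∫ t, (fderiv ℝ W (joinLast y t)).comp (snocZero n)) y := by
  have hd : Continuous (fderiv ℝ W) := hW.continuous_fderiv one_ne_zero
  obtain ⟨C, hC⟩ := hd.bounded_above_of_compact_support (hc.fderiv ℝ)
  have hK : IsCompact (lastCoord n '' tsupport W) := hc.isCompact.image (lastCoord n).continuous
  have hcomp : Continuous fun A : Rn (n + 1) →L[ℝ] F => A.comp (snocZero n) :=
    continuous_id.clm_comp continuous_const
  refine hasFDerivAt_integral_of_dominated_of_fderiv_le (𝕜 := ℝ) (s := univ)
    (F := fun z t => W (joinLast z t))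
    (F' := fun z t => (fderiv ℝ W (joinLast z t)).comp (snocZero n))
    -- The integrand vanishes unless t lies in the compact shadow of the support, whatever z is;
    -- this gives an integrable bound uniform in z.
    (bound := (lastCoord n '' tsupport W).indicator fun _ => C * ‖snocZero n‖)
    univ_mem (Eventually.of_forall fun z => ?_) ?_ ?_ ?_ ?_ ?_
  · exact (continuous_comp_joinLast hW.continuous z).aestronglyMeasurable
  · exact (continuous_comp_joinLast hW.continuous y).integrable_of_hasCompactSupport
      (hasCompactSupport_comp_joinLast hc y)
  · exact (hcomp.comp (continuous_comp_joinLast hd y)).aestronglyMeasurable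
  · refine Eventually.of_forall fun t z _ => ?_
    by_cases ht : t ∈ lastCoord n '' tsupport W
    · rw [indicator_of_mem ht]
      exact (ContinuousLinearMap.opNorm_comp_le _ _).trans (by gcongr; exact hC _)
    · rw [indicator_of_notMem ht]
      have : fderiv ℝ W (joinLast z t) = 0 := by
        by_contra h
        exact ht ⟨joinLast z t, tsupport_fderiv_subset ℝ (subset_tsupport _ h), by simp⟩
      simp [this]
  · exact (integrable_indicator_iff hK.measurableSet).2
      (integrableOn_const hK.measure_lt_top.ne)
  · exact Eventually.of_forall fun t z _ =>
      hasFDerivAt_comp_joinLast (hW.differentiable (by simp)) z t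

/-- Induction on the order of smoothness by differentiating under the integral. The target space is
quantified inside the induction, since the derivative takes values in a space of linear maps. -/
lemma contDiff_nat_integral_joinLast (m : ℕ) : ∀ {F : Type} [NormedAddCommGroup F]
    [NormedSpace ℝ F] {W : Rn (n + 1) → F}, ContDiff ℝ m W → HasCompactSupport W →
    ContDiff ℝ m (fun z => ∫ t, W (joinLast z t)) := by
  induction m with
  | zero =>
    intro F _ _ W hW hc
    rw [Nat.cast_zero, contDiff_zero] at hW ⊢
    refine continuous_iff_continuousAt.2 fun y => ?_
    obtain ⟨C, hC⟩ := hW.bounded_above_of_compact_support hc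
    have hK : IsCompact (lastCoord n '' tsupport W) := hc.isCompact.image (lastCoord n).continuous
    refine continuousAt_of_dominated
      (bound := (lastCoord n '' tsupport W).indicator fun _ => C)
      (Eventually.of_forall fun z =>
        (continuous_comp_joinLast hW z).aestronglyMeasurable)
      (Eventually.of_forall fun z => Eventually.of_forall fun t => ?_)
      ((integrable_indicator_iff hK.measurableSet).2 (integrableOn_const hK.measure_lt_top.ne))
      (Eventually.of_forall fun t => ?_)
    · by_cases ht : t ∈ lastCoord n '' tsupport W
      · rw [indicator_of_mem ht]
        exact hC _
      · rw [indicator_of_notMem ht]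
        have : W (joinLast z t) = 0 := by
          by_contra h
          exact ht ⟨joinLast z t, subset_tsupport _ h, by simp⟩
        simp [this]
    · exact (hW.comp
        (continuous_joinLast.comp (continuous_id.prodMk continuous_const))).continuousAt
  | succ m ih =>
    intro F _ _ W hW hc
    have h1 : ContDiff ℝ 1 W := hW.of_le (by simp)
    have hd := fun y => hasFDerivAt_integral_joinLast h1 hc y
    rw [Nat.cast_succ, contDiff_succ_iff_fderiv]
    refine ⟨fun y => (hd y).differentiableAt, by simp, ?_⟩
    rw [show fderiv ℝ (fun z => ∫ t, W (joinLast z t)) =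
      fun y => ∫ t, (fderiv ℝ W (joinLast y t)).comp (snocZero n) from
        funext fun y => (hd y).fderiv]
    refine ih (W := fun x => (fderiv ℝ W x).comp (snocZero n)) ?_ ?_
    · have : ContDiff ℝ m (fderiv ℝ W) := hW.fderiv_right (by simp)
      exact this.clm_comp contDiff_const
    · exact (hc.fderiv ℝ).comp_left (g := fun A : Rn (n + 1) →L[ℝ] F => A.comp (snocZero n))
        (by simp)

lemma IsTestFunction.integral_joinLast {D : Set (Rn n)} {J : Set ℝ} {w : Rn (n + 1) → ℝ}
    (hw : IsTestFunction (productDomain D J) w) :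
    IsTestFunction D (fun y => ∫ t, w (joinLast y t)) := by
  have hsub : tsupport (fun y => ∫ t, w (joinLast y t)) ⊆ dropLast n '' tsupport w := by
    refine closure_minimal ?_ (hw.2.1.isCompact.image (dropLast n).continuous).isClosed
    intro y hy
    by_contra h
    apply hy
    have : ∀ t, w (joinLast y t) = 0 := fun t => by
      by_contra ht
      exact h ⟨joinLast y t, subset_tsupport _ ht, by simp⟩
    simp [this]
  refine ⟨?_, ?_, ?_⟩
  · exact contDiff_infty.2 fun m =>
      contDiff_nat_integral_joinLast m (hw.1.of_le (mod_cast le_top)) hw.2.1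
  · exact (hw.2.1.isCompact.image (dropLast n).continuous).of_isClosed_subset
      (isClosed_tsupport _) hsub
  · refine hsub.trans ?_
    rintro _ ⟨x, hx, rfl⟩
    exact (hw.2.2 hx).1

lemma IsTestFunction.mul_lastCoord {D : Set (Rn n)} {J : Set ℝ} {w : Rn (n + 1) → ℝ}
    (hw : IsTestFunction (productDomain D J) w) {c : ℝ → ℝ} (hc : ContDiff ℝ ∞ c) :
    IsTestFunction (productDomain D J) (fun x => c (x (Fin.last n)) * w x) := by
  refine ⟨(hc.comp (lastCoord n).contDiff).mul hw.1, hw.2.1.mul_left, ?_⟩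
  exact (tsupport_mul_subset_right (f := fun x : Rn (n + 1) => c (x (Fin.last n)))).trans hw.2.2

/-- The factor c depends on the last variable only, so the horizontal gradient does not see it. -/
lemma dropLast_gradient_mul {c : ℝ → ℝ} (hc : ContDiff ℝ ∞ c) {w : Rn (n + 1) → ℝ}
    (hw : ContDiff ℝ ∞ w) (x : Rn (n + 1)) :
    dropLast n (gradient (fun x => c (x (Fin.last n)) * w x) x) =
      c (x (Fin.last n)) • dropLast n (gradient w x) := by
  refine ext_inner_right ℝ fun v => ?_
  rw [← inner_snocZero, inner_gradient, real_inner_smul_left, ← inner_snocZero, inner_gradient]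
  have h1 : HasFDerivAt (fun x : Rn (n + 1) => c (x (Fin.last n)))
      (deriv c (x (Fin.last n)) • lastCoord n) x :=
    (hc.differentiable (by simp) _).hasDerivAt.comp_hasFDerivAt x (lastCoord n).hasFDerivAt
  have h2 : HasFDerivAt w (fderiv ℝ w x) x := (hw.differentiable (by simp) x).hasFDerivAt
  rw [show (fun x => c (x (Fin.last n)) * w x) = (fun x => c (x (Fin.last n))) * w from rfl,
    (h1.mul h2).fderiv]
  simp

lemma IsTestFunction.gradient_integral_joinLast {D : Set (Rn n)} {J : Set ℝ} {w : Rn (n + 1) → ℝ}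
    (hw : IsTestFunction (productDomain D J) w) (y : Rn n) :
    gradient (fun y => ∫ t, w (joinLast y t)) y =
      ∫ t, dropLast n (gradient w (joinLast y t)) := by
  have h1 : ContDiff ℝ 1 w := hw.1.of_le (by simp)
  have hi1 : Integrable fun t => dropLast n (gradient w (joinLast y t)) :=
    (dropLast n).integrable_comp
      ((continuous_comp_joinLast hw.gradient_continuous y).integrable_of_hasCompactSupport
        (hasCompactSupport_comp_joinLast hw.gradient_hasCompactSupport y))
  have hi2 : Integrable fun t => (fderiv ℝ w (joinLast y t)).comp (snocZero n) := by
    have hcomp : Continuous fun A : Rn (n + 1) →L[ℝ] ℝ => A.comp (snocZero n) := by fun_prop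
    refine Continuous.integrable_of_hasCompactSupport
      (hcomp.comp (continuous_comp_joinLast (h1.continuous_fderiv one_ne_zero) y)) ?_
    exact (hasCompactSupport_comp_joinLast (hw.2.1.fderiv ℝ) y).comp_left
      (g := fun A : Rn (n + 1) →L[ℝ] ℝ => A.comp (snocZero n)) (by simp)
  refine ext_inner_right ℝ fun v => ?_
  rw [inner_gradient, (hasFDerivAt_integral_joinLast h1 hw.2.1 y).fderiv,
    ContinuousLinearMap.integral_apply hi2, real_inner_comm, ← integral_inner hi1]
  refine integral_congr_ae (Eventually.of_forall fun t => ?_)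
  simp only [ContinuousLinearMap.comp_apply]
  rw [real_inner_comm, ← inner_snocZero, inner_gradient]

end TestFunctions

lemma adjoint_id_real : ContinuousLinearMap.adjoint (ContinuousLinearMap.id ℝ ℝ) =
    ContinuousLinearMap.id ℝ ℝ :=
  ((ContinuousLinearMap.eq_adjoint_iff _ _).2 fun _ _ => rfl).symm

/-- The partial sine coefficient of a function in `H¹₀(D × J)` lies in `H¹₀(D)`. -/
lemma adjoint_tensorLast_mem_H10 {n : ℕ} {D : Set (Rn n)} (hD : MeasurableSet D) {J : Set ℝ}
    (hJ : volume J ≠ ⊤) (c : ℝ →ᵇ ℝ) (hc : ContDiff ℝ ∞ c)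
    {u : L2Fun (productDomain D J)} {G : L2Field (productDomain D J)}
    (h : (u, G) ∈ H10 (productDomain D J)) :
    (ContinuousLinearMap.adjoint (tensorLast D hJ c (ContinuousLinearMap.id ℝ ℝ)) u,
      ContinuousLinearMap.adjoint (tensorLast D hJ c (snocZero n)) G) ∈ H10 D := by
  -- Φ is continuous and `H10 D` is closed, so test functions w suffice. For these the two
  -- components are ∫ c w dt, a test function on D, and its gradient, because the adjoint of
  -- `snocZero` keeps the horizontal part.
  let Φ := (ContinuousLinearMap.adjoint (tensorLast D hJ c (ContinuousLinearMap.id ℝ ℝ))).prodMap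
    (ContinuousLinearMap.adjoint (tensorLast D hJ c (snocZero n)))
  refine mem_of_mem_H10 (S := Φ ⁻¹' (H10 D : Set _))
    ((Submodule.isClosed_topologicalClosure _).preimage Φ.continuous) ?_ h
  rintro ⟨u, G⟩ ⟨w, hw, hu, hG⟩
  have hcw := hw.mul_lastCoord hc
  have hT := hcw.integral_joinLast
  -- This lets the integral over J be replaced by one over the whole line, where differentiation
  -- under the integral applies.
  have hout : ∀ (y : Rn n) (t : ℝ), t ∉ J → joinLast y t ∉ tsupport w := fun y t ht hx =>
    ht (by simpa using (hw.2.2 hx).2)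
  refine hT.mem_H10 ?_ ?_
  · refine coeFn_adjoint_tensorLast hJ c _ u hu hT.memLp (fun y _ => ?_) (fun y _ => ?_) hD
    · rw [setIntegral_eq_integral_of_forall_compl_eq_zero]
      · simp [adjoint_id_real]
      · intro t ht
        simp [image_eq_zero_of_notMem_tsupport (hout y t ht)]
    · exact ((continuous_comp_joinLast hw.1.continuous y).integrable_of_hasCompactSupport
        (hasCompactSupport_comp_joinLast hw.2.1 y)).integrableOn
  · refine coeFn_adjoint_tensorLast hJ c _ G hG hT.memLp_gradient (fun y _ => ?_)
      (fun y _ => ?_) hD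
    · rw [hcw.gradient_integral_joinLast, setIntegral_eq_integral_of_forall_compl_eq_zero]
      · simp [adjoint_snocZero, dropLast_gradient_mul hc hw.1]
      · intro t ht
        have : joinLast y t ∉ tsupport (gradient w) := fun h =>
          hout y t ht (tsupport_gradient_subset w h)
        simp [image_eq_zero_of_notMem_tsupport this]
    · exact ((continuous_comp_joinLast hw.gradient_continuous y).integrable_of_hasCompactSupport
        (hasCompactSupport_comp_joinLast hw.gradient_hasCompactSupport y)).integrableOn

/-! ### Separation of variables -/

/-- Integration by parts in the last variable. -/
lemma inner_tensorLast_lastVec {n : ℕ} {D : Set (Rn n)} {J : Set ℝ} (hJ : volume J ≠ ⊤)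
    {s b : ℝ →ᵇ ℝ} {κ : ℝ}
    (hb : ∀ t, HasDerivAt b (-κ ^ 2 * s t) t) {φ : Rn n → ℝ} (hφ : IsTestFunction D φ)
    {f : L2Fun D} (hf : f =ᵐ[volume.restrict D] φ)
    {u : L2Fun (productDomain D J)} {G : L2Field (productDomain D J)}
    (h : (u, G) ∈ H10 (productDomain D J)) :
    inner ℝ G (tensorLast D hJ b (ContinuousLinearMap.toSpanSingleton ℝ (lastVec n)) f) =
      κ ^ 2 * inner ℝ u (tensorLast D hJ s (ContinuousLinearMap.id ℝ ℝ) f) := by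
  refine mem_of_mem_H10 (p := (u, G)) (S := {p | inner ℝ p.2 (tensorLast D hJ b
      (ContinuousLinearMap.toSpanSingleton ℝ (lastVec n)) f) =
      κ ^ 2 * inner ℝ p.1 (tensorLast D hJ s (ContinuousLinearMap.id ℝ ℝ) f)})
    (isClosed_eq (by fun_prop) (by fun_prop)) ?_ h
  rintro ⟨u, G⟩ ⟨w, hw, hu, hG⟩
  simp only at hu hG
  simp only [mem_ofPred_eq]
  have hbc : Continuous (fun x : Rn (n + 1) => b (x (Fin.last n))) :=
    b.continuous.comp (lastCoord n).continuous
  have hsc : Continuous (fun x : Rn (n + 1) => s (x (Fin.last n))) :=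
    s.continuous.comp (lastCoord n).continuous
  have hφc : Continuous (fun x : Rn (n + 1) => φ (dropLast n x)) :=
    hφ.1.continuous.comp (dropLast n).continuous
  have hder : ∀ x : Rn (n + 1), HasFDerivAt
      (fun x : Rn (n + 1) => b (x (Fin.last n)) * φ (dropLast n x))
      (b (x (Fin.last n)) • (fderiv ℝ φ (dropLast n x)).comp (dropLast n) +
        φ (dropLast n x) • ((-κ ^ 2 * s (x (Fin.last n))) • lastCoord n)) x := fun x => by
    have h1 : HasFDerivAt (fun x : Rn (n + 1) => b (x (Fin.last n)))
        ((-κ ^ 2 * s (x (Fin.last n))) • lastCoord n) x :=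
      (hb _).comp_hasFDerivAt x (lastCoord n).hasFDerivAt
    have h2 : HasFDerivAt (fun x : Rn (n + 1) => φ (dropLast n x))
        ((fderiv ℝ φ (dropLast n x)).comp (dropLast n)) x :=
      (hφ.1.differentiable (by simp) _).hasFDerivAt.comp x (dropLast n).hasFDerivAt
    exact h1.mul h2
  have hv : ∀ x : Rn (n + 1), fderiv ℝ
      (fun x : Rn (n + 1) => b (x (Fin.last n)) * φ (dropLast n x)) x (lastVec n) =
      -κ ^ 2 * (s (x (Fin.last n)) * φ (dropLast n x)) := fun x => by
    rw [(hder x).fderiv]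
    simp
    ring
  have hwc := hw.1.continuous
  have hdw : Continuous fun x => fderiv ℝ w x (lastVec n) :=
    (hw.1.continuous_fderiv (by simp)).clm_apply continuous_const
  have hdws : HasCompactSupport fun x => fderiv ℝ w x (lastVec n) :=
    (hw.2.1.fderiv ℝ).comp_left (g := fun A : Rn (n + 1) →L[ℝ] ℝ => A (lastVec n)) (by simp)
  -- The integration runs over the whole space. The compact support of w removes boundary terms, so
  -- b itself need not vanish at the ends of J.
  have key := integral_mul_fderiv_eq_neg_fderiv_mul_of_integrable (𝕜 := ℝ) (μ := volume)
    (f := fun x : Rn (n + 1) => b (x (Fin.last n)) * φ (dropLast n x)) (g := w) (v := lastVec n)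
    (by
      simp only [hv]
      refine Continuous.integrable_of_hasCompactSupport ?_ hw.2.1.mul_left
      exact (continuous_const.mul (hsc.mul hφc)).mul hwc)
    (by
      refine Continuous.integrable_of_hasCompactSupport ?_ hdws.mul_left
      exact (hbc.mul hφc).mul hdw)
    (by
      refine Continuous.integrable_of_hasCompactSupport ?_ hw.2.1.mul_left
      exact (hbc.mul hφc).mul hwc)
    (fun x _ => (hder x).differentiableAt) (fun x _ => hw.1.differentiable (by simp) x)
  simp only [hv] at key
  have hout : ∀ x, x ∉ productDomain D J → x ∉ tsupport w := fun x hx h => hx (hw.2.2 h)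
  rw [L2.inner_def, L2.inner_def, ← integral_const_mul]
  have h1 : ∀ᵐ x ∂volume.restrict (productDomain D J), inner ℝ (G x) (tensorLast D hJ b
      (ContinuousLinearMap.toSpanSingleton ℝ (lastVec n)) f x) =
      b (x (Fin.last n)) * φ (dropLast n x) * fderiv ℝ w x (lastVec n) := by
    filter_upwards [hG, coeFn_tensorLast_of_ae hJ b
      (ContinuousLinearMap.toSpanSingleton ℝ (lastVec n)) hf] with x h1 h2
    rw [h1, h2, ← inner_gradient]
    simp only [ContinuousLinearMap.toSpanSingleton_apply, real_inner_smul_right]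
    ring
  have h2 : ∀ᵐ x ∂volume.restrict (productDomain D J), κ ^ 2 * inner ℝ (u x) (tensorLast D hJ s
      (ContinuousLinearMap.id ℝ ℝ) f x) =
      -(-κ ^ 2 * (s (x (Fin.last n)) * φ (dropLast n x)) * w x) := by
    filter_upwards [hu, coeFn_tensorLast_of_ae hJ s
      (ContinuousLinearMap.id ℝ ℝ) hf] with x h1 h2
    rw [h1, h2]
    simp
    ring
  rw [integral_congr_ae h1, integral_congr_ae h2, setIntegral_eq_integral_of_forall_compl_eq_zero,
    setIntegral_eq_integral_of_forall_compl_eq_zero, key, integral_neg]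
  · intro x hx
    simp [image_eq_zero_of_notMem_tsupport (hout x hx)]
  · intro x hx
    have : fderiv ℝ w x = 0 := image_eq_zero_of_notMem_tsupport
      (fun h => hout x hx (tsupport_fderiv_subset ℝ h))
    simp [this]

/-! ### Testing with functions that only vanish at the endpoints -/

/-- Weak convergence needs only pointwise limits and a uniform bound, by dominated convergence. The
cutoffs below have exactly these properties; their derivatives need not converge uniformly. -/
lemma tendsto_inner_tensorLast {n : ℕ} {E F : Type*} [NormedAddCommGroup E]
    [NormedAddCommGroup F] [InnerProductSpace ℝ E] [InnerProductSpace ℝ F]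
    {D : Set (Rn n)} {J : Set ℝ} (hJ : volume J ≠ ⊤) (hm : MeasurableSet (productDomain D J))
    {c : ℕ → ℝ →ᵇ ℝ} {c₀ : ℝ →ᵇ ℝ} {B : ℝ} (hB : ∀ m t, |c m t| ≤ B)
    (hlim : ∀ t ∈ J, Tendsto (fun m => c m t) atTop (𝓝 (c₀ t))) (A : E →L[ℝ] F)
    (f : Lp E 2 (volume.restrict D)) (w : Lp F 2 (volume.restrict (productDomain D J))) :
    Tendsto (fun m => inner ℝ w (tensorLast D hJ (c m) A f)) atTop
      (𝓝 (inner ℝ w (tensorLast D hJ c₀ A f))) := by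
  simp only [L2.inner_def]
  have hAf : MemLp (fun x => A (f (dropLast n x))) 2 (volume.restrict (productDomain D J)) :=
    A.comp_memLp' (memLp_comp_dropLast hJ (Lp.memLp f))
  refine tendsto_integral_of_dominated_convergence
    (fun x => ‖w x‖ * (B * ‖A (f (dropLast n x))‖)) (fun m => ?_) ?_ (fun m => ?_) ?_
  · exact (L2.integrable_inner _ _).1
  · have h := ((Lp.memLp w).norm.integrable_mul hAf.norm).const_mul B
    refine h.congr (Eventually.of_forall fun x => ?_)
    simp only [Pi.mul_apply]
    ring
  · filter_upwards [coeFn_tensorLast D hJ (c m) A f] with x hx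
    refine (norm_inner_le_norm _ _).trans ?_
    gcongr
    rw [hx, norm_smul]
    gcongr
    exact hB m _
  · have hall : ∀ᵐ x ∂volume.restrict (productDomain D J), ∀ m,
        tensorLast D hJ (c m) A f x = c m (x (Fin.last n)) • A (f (dropLast n x)) :=
      ae_all_iff.2 fun m => coeFn_tensorLast D hJ (c m) A f
    filter_upwards [hall, coeFn_tensorLast D hJ c₀ A f, ae_restrict_mem hm] with x h1 h2 h3
    simp only [h1, h2]
    exact tendsto_const_nhds.inner ((hlim _ h3.2).smul_const _)

/-- A smooth function that vanishes at the endpoints of an interval is approximated, together with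
its derivative, by functions with compact support in the open interval. -/
lemma exists_cutoff {a b : ℝ} (hab : a < b) {s s' : ℝ →ᵇ ℝ} (hs : ContDiff ℝ ∞ s)
    (hd : ∀ t, HasDerivAt s (s' t) t) (ha : s a = 0) (hb : s b = 0) :
    ∃ (χ χ' : ℕ → ℝ →ᵇ ℝ) (B : ℝ), (∀ m, ContDiff ℝ ∞ (χ m)) ∧
      (∀ m t, HasDerivAt (χ m) (χ' m t) t) ∧
      (∀ m, ∃ K, IsCompact K ∧ K ⊆ Ioo a b ∧ ∀ t ∉ K, χ m t = 0) ∧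
      (∀ m t, |χ m t| ≤ B) ∧ (∀ m t, |χ' m t| ≤ B) ∧
      (∀ t ∈ Ioo a b, Tendsto (fun m => χ m t) atTop (𝓝 (s t))) ∧
      (∀ t ∈ Ioo a b, Tendsto (fun m => χ' m t) atTop (𝓝 (s' t))) := by
  -- The approximants are s · η(m p): p is positive exactly on (a, b), and η is 0 up to 1 and 1 from
  -- 2 on.
  set p : ℝ → ℝ := fun t => (t - a) * (b - t) with hp
  set η : ℝ → ℝ := fun y => Real.smoothTransition (y - 1) with hη
  have hηs : ContDiff ℝ ∞ η := Real.smoothTransition.contDiff.comp (contDiff_id.sub contDiff_const)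
  have hpS : ContDiff ℝ ∞ p := by rw [hp]; fun_prop
  have hη0 : ∀ y ≤ 1, η y = 0 := fun y hy =>
    Real.smoothTransition.zero_of_nonpos (by linarith)
  have hη1 : ∀ y, 2 ≤ y → η y = 1 := fun y hy =>
    Real.smoothTransition.one_of_one_le (by linarith)
  have hηb : ∀ y, |η y| ≤ 1 := fun y => by
    rw [abs_of_nonneg (Real.smoothTransition.nonneg _)]
    exact Real.smoothTransition.le_one _
  have hηd0 : ∀ y < 1, deriv η y = 0 := fun y hy => by
    have : η =ᶠ[𝓝 y] fun _ => 0 := by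
      filter_upwards [Iio_mem_nhds hy] with z hz using hη0 z (le_of_lt hz)
    rw [this.deriv_eq, deriv_const]
  have hηd1 : ∀ y, 2 < y → deriv η y = 0 := fun y hy => by
    have : η =ᶠ[𝓝 y] fun _ => 1 := by
      filter_upwards [Ioi_mem_nhds hy] with z hz using hη1 z (le_of_lt hz)
    rw [this.deriv_eq, deriv_const]
  have hηc : Continuous (deriv η) := hηs.continuous_deriv (by simp)
  -- η' lives on [1, 2], so y η'(y) is bounded. This absorbs the factor m produced by
  -- differentiating η(m p).
  obtain ⟨M, hM⟩ : ∃ M, ∀ y, ‖y * deriv η y‖ ≤ M := by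
    refine (continuous_id.mul hηc).bounded_above_of_compact_support ?_
    refine HasCompactSupport.intro (isCompact_Icc (a := (1 : ℝ)) (b := 2)) fun y hy => ?_
    rw [mem_Icc, not_and_or, not_le, not_le] at hy
    rcases hy with hy | hy
    · simp [hηd0 y hy]
    · simp [hηd1 y hy]
  have hM0 : 0 ≤ M := (norm_nonneg _).trans (hM 0)
  have hout : ∀ t ∉ Ioo a b, p t ≤ 0 := fun t ht => by
    rw [mem_Ioo, not_and_or, not_lt, not_lt] at ht
    rcases ht with ht | ht
    · exact mul_nonpos_of_nonpos_of_nonneg (by linarith) (by linarith)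
    · exact mul_nonpos_of_nonneg_of_nonpos (by linarith) (by linarith)
  have hlip : ∀ x y, |s y - s x| ≤ ‖s'‖ * |y - x| := fun x y =>
    convex_univ.norm_image_sub_le_of_norm_hasDerivWithin_le
      (fun t _ => (hd t).hasDerivWithinAt) (fun t _ => s'.norm_coe_le_norm t)
      (mem_univ x) (mem_univ y)
  -- Since s vanishes at both ends, |s| is at most ‖s'‖(t - a) and ‖s'‖(b - t). Weighting these by b
  -- - t and t - a and adding gives |s| ≲ p, so s · m η'(m p) is controlled by m p η'(m p).
  have hsp : ∀ t ∈ Ioo a b, |s t| * (b - a) ≤ 2 * ‖s'‖ * p t := fun t ht => by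
    have h1 := hlip a t
    have h2 := hlip b t
    rw [ha, sub_zero, abs_of_pos (sub_pos.2 ht.1)] at h1
    rw [hb, sub_zero, abs_of_neg (sub_neg.2 ht.2)] at h2
    have e1 := mul_le_mul_of_nonneg_right h1 (sub_pos.2 ht.2).le
    have e2 := mul_le_mul_of_nonneg_right h2 (sub_pos.2 ht.1).le
    simp only [hp]
    nlinarith
  have hχd : ∀ (m : ℕ) t, HasDerivAt (fun t => s t * η (m * p t))
      (s' t * η (m * p t) + s t * (deriv η (m * p t) * (m * (a + b - 2 * t)))) t := fun m t => by
    have h1 : HasDerivAt p (a + b - 2 * t) t := by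
      exact (((hasDerivAt_id' t).sub_const a).mul ((hasDerivAt_id' t).const_sub b)).congr_deriv
        (by ring)
    have h2 := (hηs.differentiable (by simp) (m * p t)).hasDerivAt.comp t (h1.const_mul (m : ℝ))
    exact (hd t).mul h2
  have hb1 : ∀ (m : ℕ) t, ‖s t * η (m * p t)‖ ≤ ‖s‖ := fun m t => by
    rw [norm_mul]
    calc _ ≤ ‖s‖ * 1 := by gcongr; exacts [s.norm_coe_le_norm t, hηb _]
      _ = _ := mul_one _
  have hb2 : ∀ (m : ℕ) t, ‖s' t * η (m * p t) +
      s t * (deriv η (m * p t) * (m * (a + b - 2 * t)))‖ ≤ ‖s'‖ + 2 * ‖s'‖ * M := fun m t => by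
    refine (norm_add_le _ _).trans (add_le_add ?_ ?_)
    · rw [norm_mul]
      calc _ ≤ ‖s'‖ * 1 := by gcongr; exacts [s'.norm_coe_le_norm t, hηb _]
        _ = _ := mul_one _
    · by_cases ht : t ∈ Ioo a b
      · have hpt : 0 < p t := mul_pos (sub_pos.2 ht.1) (sub_pos.2 ht.2)
        have h1 : |a + b - 2 * t| ≤ b - a := by
          rw [abs_le]; constructor <;> linarith [ht.1, ht.2]
        have h2 := hM (m * p t)
        rw [norm_mul, norm_mul, Real.norm_of_nonneg hpt.le, Real.norm_natCast] at h2
        simp only [norm_mul, Real.norm_natCast]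
        calc ‖s t‖ * (‖deriv η (m * p t)‖ * (m * ‖a + b - 2 * t‖))
            ≤ ‖s t‖ * (‖deriv η (m * p t)‖ * (m * (b - a))) := by gcongr; exact h1
          _ = (|s t| * (b - a)) * (m * ‖deriv η (m * p t)‖) := by rw [Real.norm_eq_abs (s t)]; ring
          _ ≤ (2 * ‖s'‖ * p t) * (m * ‖deriv η (m * p t)‖) := 
            mul_le_mul_of_nonneg_right (hsp t ht) (by positivity)
          _ = 2 * ‖s'‖ * (m * p t * ‖deriv η (m * p t)‖) := by ring
          _ ≤ _ := by gcongr
      · have : deriv η (m * p t) = 0 := hηd0 _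
          ((mul_nonpos_of_nonneg_of_nonpos m.cast_nonneg (hout t ht)).trans_lt one_pos)
        rw [this]
        simp only [zero_mul, mul_zero, norm_zero]
        positivity
  have hcs : ∀ m : ℕ, ContDiff ℝ ∞ (fun t => s t * η (m * p t)) := fun m =>
    hs.mul (hηs.comp (contDiff_const.mul hpS))
  have hcd : ∀ m : ℕ, Continuous (fun t => s' t * η (m * p t) +
      s t * (deriv η (m * p t) * (m * (a + b - 2 * t)))) := fun m => by
    have := hηs.continuous
    have := hpS.continuous
    have := s.continuous
    have := s'.continuous
    fun_prop
  have hev : ∀ t ∈ Ioo a b, ∀ᶠ m : ℕ in atTop, 2 < m * p t := fun t ht =>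
    (tendsto_natCast_atTop_atTop.atTop_mul_const
      (mul_pos (sub_pos.2 ht.1) (sub_pos.2 ht.2))).eventually_gt_atTop 2
  refine ⟨fun m => .ofNormedAddCommGroup _ (hcs m).continuous _ (hb1 m),
    fun m => .ofNormedAddCommGroup _ (hcd m) _ (hb2 m), ‖s‖ + (‖s'‖ + 2 * ‖s'‖ * M),
    hcs, hχd, fun m => ?_, fun m t => ?_, fun m t => ?_, fun t ht => ?_, fun t ht => ?_⟩
  · refine ⟨Icc a b ∩ {t | 1 ≤ m * p t}, isCompact_Icc.inter_right
      (isClosed_le continuous_const (continuous_const.mul hpS.continuous)), ?_, ?_⟩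
    · rintro t ⟨-, ht⟩
      by_contra h
      have := mul_nonpos_of_nonneg_of_nonpos (m.cast_nonneg (α := ℝ)) (hout t h)
      have : (1 : ℝ) ≤ m * p t := ht
      linarith
    · intro t ht
      have : m * p t ≤ 1 := by
        by_contra! h
        refine ht ⟨?_, h.le⟩
        by_contra hI
        have := mul_nonpos_of_nonneg_of_nonpos (m.cast_nonneg (α := ℝ))
          (hout t fun h => hI (Ioo_subset_Icc_self h))
        linarith
      simp [hη0 _ this]
  · exact (hb1 m t).trans (le_add_of_nonneg_right (by positivity))
  · exact (hb2 m t).trans (le_add_of_nonneg_left (by positivity))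
  · refine tendsto_const_nhds.congr' ?_
    filter_upwards [hev t ht] with m hm
    simp [hη1 _ hm.le]
  · refine tendsto_const_nhds.congr' ?_
    filter_upwards [hev t ht] with m hm
    simp [hη1 _ hm.le, hηd1 _ hm]

lemma IsTestFunction.tensor {n : ℕ} {D : Set (Rn n)} {J K : Set ℝ} {φ : Rn n → ℝ}
    (hφ : IsTestFunction D φ) {χ : ℝ → ℝ} (hχ : ContDiff ℝ ∞ χ) (hK : IsCompact K) (hKJ : K ⊆ J)
    (h0 : ∀ t ∉ K, χ t = 0) :
    IsTestFunction (productDomain D J) (fun x => χ (x (Fin.last n)) * φ (dropLast n x)) := by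
  have hC := isCompact_productDomain hφ.2.1.isCompact hK
  have hsub : tsupport (fun x : Rn (n + 1) => χ (x (Fin.last n)) * φ (dropLast n x)) ⊆
      productDomain (tsupport φ) K := by
    refine closure_minimal (fun x hx => ?_) hC.isClosed
    rw [Function.mem_support, mul_ne_zero_iff] at hx
    exact ⟨subset_tsupport _ hx.2, by_contra fun h => hx.1 (h0 _ h)⟩
  refine ⟨(hχ.comp (lastCoord n).contDiff).mul (hφ.1.comp (dropLast n).contDiff),
    hC.of_isClosed_subset (isClosed_tsupport _) hsub, hsub.trans fun x hx => ?_⟩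
  exact ⟨hφ.2.2 hx.1, hKJ hx.2⟩

lemma gradient_tensor {n : ℕ} {φ : Rn n → ℝ} (hφ : Differentiable ℝ φ) {χ : ℝ → ℝ} {χ' : ℝ}
    {x : Rn (n + 1)} (hχ : HasDerivAt χ χ' (x (Fin.last n))) :
    gradient (fun x : Rn (n + 1) => χ (x (Fin.last n)) * φ (dropLast n x)) x =
      χ (x (Fin.last n)) • snocZero n (gradient φ (dropLast n x)) +
        χ' • φ (dropLast n x) • lastVec n := by
  have h1 : HasFDerivAt (fun x : Rn (n + 1) => χ (x (Fin.last n))) (χ' • lastCoord n) x :=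
    hχ.comp_hasFDerivAt x (lastCoord n).hasFDerivAt
  have h2 : HasFDerivAt (fun x : Rn (n + 1) => φ (dropLast n x))
      ((fderiv ℝ φ (dropLast n x)).comp (dropLast n)) x :=
    (hφ _).hasFDerivAt.comp x (dropLast n).hasFDerivAt
  refine ext_inner_right ℝ fun v => ?_
  rw [inner_gradient, show (fun x : Rn (n + 1) => χ (x (Fin.last n)) * φ (dropLast n x)) =
    (fun x : Rn (n + 1) => χ (x (Fin.last n))) * (fun x => φ (dropLast n x)) from rfl,
    (h1.mul h2).fderiv, inner_add_left, real_inner_smul_left, real_inner_smul_left,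
    real_inner_smul_left, real_inner_comm, inner_snocZero, real_inner_comm, inner_gradient,
    real_inner_comm, inner_lastVec]
  simp
  ring

/-- The weak equation on a product, tested with the product of a test function and a function that
vanishes at the endpoints of the interval. -/
lemma inner_tensorLast_of_mem_eigenspace {n : ℕ} {D : Set (Rn n)} {a b : ℝ} (hab : a < b)
    (hJ : volume (Ioo a b) ≠ ⊤) (hm : MeasurableSet (productDomain D (Ioo a b)))
    {s s' : ℝ →ᵇ ℝ} (hs : ContDiff ℝ ∞ s) (hd : ∀ t, HasDerivAt s (s' t) t) (ha : s a = 0)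
    (hb : s b = 0) {lam : ℝ} {u : L2Fun (productDomain D (Ioo a b))}
    {G : L2Field (productDomain D (Ioo a b))}
    (h : ∀ (v : L2Fun (productDomain D (Ioo a b))) (H : L2Field (productDomain D (Ioo a b))),
      (v, H) ∈ H10 (productDomain D (Ioo a b)) → inner ℝ G H = lam * inner ℝ u v)
    {φ : Rn n → ℝ} (hφ : IsTestFunction D φ) {f : L2Fun D} (hf : f =ᵐ[volume.restrict D] φ)
    {H : L2Field D} (hH : H =ᵐ[volume.restrict D] gradient φ) :
    inner ℝ G (tensorLast D hJ s (snocZero n) H) +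
      inner ℝ G (tensorLast D hJ s' (ContinuousLinearMap.toSpanSingleton ℝ (lastVec n)) f) =
      lam * inner ℝ u (tensorLast D hJ s (ContinuousLinearMap.id ℝ ℝ) f) := by
  -- s(t)φ(y) need not have compact support in the open product, so the equation is tested with
  -- χ_m(t)φ(y) and m tends to infinity.
  obtain ⟨χ, χ', B, hχ, hχd, hK, hB, hB', hlim, hlim'⟩ := exists_cutoff hab hs hd ha hb
  have h1 := tendsto_inner_tensorLast hJ hm hB hlim (snocZero n) H G
  have h2 := tendsto_inner_tensorLast hJ hm hB' hlim'
    (ContinuousLinearMap.toSpanSingleton ℝ (lastVec n)) f G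
  have h3 := (tendsto_inner_tensorLast hJ hm hB hlim
    (ContinuousLinearMap.id ℝ ℝ) f u).const_mul lam
  have key : ∀ m, inner ℝ G (tensorLast D hJ (χ m) (snocZero n) H) +
      inner ℝ G (tensorLast D hJ (χ' m) (ContinuousLinearMap.toSpanSingleton ℝ (lastVec n)) f) =
      lam * inner ℝ u (tensorLast D hJ (χ m) (ContinuousLinearMap.id ℝ ℝ) f) := fun m => by
    obtain ⟨K, hKc, hKJ, hK0⟩ := hK m
    have hmem : (tensorLast D hJ (χ m) (ContinuousLinearMap.id ℝ ℝ) f,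
        tensorLast D hJ (χ m) (snocZero n) H +
          tensorLast D hJ (χ' m) (ContinuousLinearMap.toSpanSingleton ℝ (lastVec n)) f) ∈
        H10 (productDomain D (Ioo a b)) := by
      refine (hφ.tensor (hχ m) hKc hKJ hK0).mem_H10 ?_ ?_
      · filter_upwards [coeFn_tensorLast_of_ae hJ (χ m) (ContinuousLinearMap.id ℝ ℝ) hf] with x hx
        simp [hx]
      · refine (Lp.coeFn_add _ _).trans ?_
        filter_upwards [coeFn_tensorLast_of_ae hJ (χ m) (snocZero n) hH,
          coeFn_tensorLast_of_ae hJ (χ' m)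
            (ContinuousLinearMap.toSpanSingleton ℝ (lastVec n)) hf] with x e1 e2
        rw [Pi.add_apply, e1, e2, gradient_tensor (hφ.1.differentiable (by simp)) (hχd m _)]
        rfl
    have := h _ _ hmem
    rwa [inner_add_right] at this
  refine tendsto_nhds_unique (h1.add h2) (h3.congr fun m => (key m).symm)

/-- The partial sine coefficients of an eigenfunction on `D × (a, b)` are eigenfunctions on `D`. -/
lemma adjoint_tensorLast_mem_dirichletEigenspace {n : ℕ} {D : Set (Rn n)} (hD : IsOpen D)
    {a b : ℝ} (hab : a < b) (hJ : volume (Ioo a b) ≠ ⊤)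
    {s s' : ℝ →ᵇ ℝ} {κ : ℝ} (hs : ContDiff ℝ ∞ s) (hd : ∀ t, HasDerivAt s (s' t) t)
    (hd' : ∀ t, HasDerivAt s' (-κ ^ 2 * s t) t) (ha : s a = 0) (hb : s b = 0) {lam : ℝ}
    {u : L2Fun (productDomain D (Ioo a b))}
    (hu : u ∈ dirichletEigenspace (productDomain D (Ioo a b)) lam) :
    ContinuousLinearMap.adjoint (tensorLast D hJ s (ContinuousLinearMap.id ℝ ℝ)) u ∈
      dirichletEigenspace D (lam - κ ^ 2) := by
  obtain ⟨G, hG, h⟩ := hu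
  have hm := (isOpen_productDomain hD (isOpen_Ioo (a := a) (b := b))).measurableSet
  refine ⟨_, adjoint_tensorLast_mem_H10 hD.measurableSet hJ s hs hG, fun v H hvH => ?_⟩
  refine mem_of_mem_H10 (p := (v, H)) (S := {p | inner ℝ (ContinuousLinearMap.adjoint
      (tensorLast D hJ s (snocZero n)) G) p.2 = (lam - κ ^ 2) *
      inner ℝ (ContinuousLinearMap.adjoint (tensorLast D hJ s (ContinuousLinearMap.id ℝ ℝ)) u) p.1})
    (isClosed_eq (by fun_prop) (by fun_prop)) ?_ hvH
  rintro ⟨f, H⟩ ⟨φ, hφ, hf, hH⟩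
  simp only at hf hH
  simp only [mem_ofPred_eq, ContinuousLinearMap.adjoint_inner_left]
  -- The full weak equation has a horizontal and a vertical term; integration by parts identifies
  -- the vertical one as κ² times the mass term. Their difference is the equation on D with λ - κ².
  have e1 := inner_tensorLast_of_mem_eigenspace hab hJ hm hs hd ha hb h hφ hf hH
  have e2 := inner_tensorLast_lastVec hJ hd' hφ hf hG
  linarith

/-! ### Completeness of the sine system -/

/-- The function `t ↦ sin (κ (t - a))`. -/
def sineFun (a κ : ℝ) : ℝ →ᵇ ℝ :=
  .ofNormedAddCommGroup (fun t => Real.sin (κ * (t - a))) (by fun_prop) 1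
    fun t => Real.abs_sin_le_one _

/-- The derivative of `sineFun a κ`. -/
def sineFunDeriv (a κ : ℝ) : ℝ →ᵇ ℝ :=
  .ofNormedAddCommGroup (fun t => κ * Real.cos (κ * (t - a))) (by fun_prop) |κ|
    fun t => by
      rw [Real.norm_eq_abs, abs_mul]
      exact mul_le_of_le_one_right (abs_nonneg _) (Real.abs_cos_le_one _)

@[simp] lemma sineFun_apply (a κ t : ℝ) : sineFun a κ t = Real.sin (κ * (t - a)) := rfl

@[simp] lemma sineFunDeriv_apply (a κ t : ℝ) :
    sineFunDeriv a κ t = κ * Real.cos (κ * (t - a)) := rfl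

lemma contDiff_sineFun (a κ : ℝ) : ContDiff ℝ ∞ (sineFun a κ) :=
  Real.contDiff_sin.comp (contDiff_const.mul (contDiff_id.sub contDiff_const))

lemma hasDerivAt_sineFun (a κ t : ℝ) : HasDerivAt (sineFun a κ) (sineFunDeriv a κ t) t := by
  have h := (((hasDerivAt_id' t).sub_const a).const_mul κ).sin
  exact h.congr_deriv (by simp; ring)

lemma hasDerivAt_sineFunDeriv (a κ t : ℝ) :
    HasDerivAt (sineFunDeriv a κ) (-κ ^ 2 * sineFun a κ t) t := by
  have h := ((((hasDerivAt_id' t).sub_const a).const_mul κ).cos).const_mul κ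
  exact h.congr_deriv (by simp; ring)

/-- The frequency `π l / L`. -/
def freq (L : ℝ) (l : ℕ) : ℝ := Real.pi * l / L

lemma sineFun_freq_left (a κ : ℝ) : sineFun a κ a = 0 := by simp

lemma sineFun_freq_right (a : ℝ) {L : ℝ} (hL : 0 < L) (l : ℕ) :
    sineFun a (freq L l) (a + L) = 0 := by
  have : freq L l * (a + L - a) = l * Real.pi := by unfold freq; field_simp; ring
  rw [sineFun_apply, this, Real.sin_nat_mul_pi]

section SineOrthogonal

variable {n : ℕ}

/-- `u` is integrable and orthogonal to all products `f(y) sin(π l (t - a) / L)`. -/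
def SineOrthogonal (D : Set (Rn n)) (a L : ℝ) (u : Rn (n + 1) → ℝ) : Prop :=
  IntegrableOn u (productDomain D (Ioo a (a + L))) ∧ ∀ f : Rn n → ℝ, Continuous f → ∀ l : ℕ,
    ∫ x in productDomain D (Ioo a (a + L)),
      u x * (f (dropLast n x) * sineFun a (freq L l) (x (Fin.last n))) = 0

lemma productDomain_subset_compact (D : Set (Rn n)) (a b : ℝ) :
    productDomain D (Ioo a b) ⊆ productDomain (closure D) (Icc a b) :=
  fun _ hx => ⟨subset_closure hx.1, Ioo_subset_Icc_self hx.2⟩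

lemma integrableOn_mul_continuous {D : Set (Rn n)} (hD : IsOpen D) (hb : Bornology.IsBounded D)
    {a b : ℝ} {u g : Rn (n + 1) → ℝ} (hu : IntegrableOn u (productDomain D (Ioo a b)))
    (hg : Continuous g) : IntegrableOn (fun x => u x * g x) (productDomain D (Ioo a b)) :=
  hu.mul_continuousOn_of_subset hg.continuousOn (isOpen_productDomain hD isOpen_Ioo).measurableSet
    (isCompact_productDomain hb.isCompact_closure isCompact_Icc)
    (productDomain_subset_compact D a b)

lemma continuous_tensor {f : Rn n → ℝ} (hf : Continuous f) {g : ℝ → ℝ} (hg : Continuous g) :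
    Continuous fun x : Rn (n + 1) => f (dropLast n x) * g (x (Fin.last n)) :=
  (hf.comp (dropLast n).continuous).mul (hg.comp (lastCoord n).continuous)

lemma SineOrthogonal.add {D : Set (Rn n)} (hD : IsOpen D) (hb : Bornology.IsBounded D) {a L : ℝ}
    {u v : Rn (n + 1) → ℝ} (hu : SineOrthogonal D a L u) (hv : SineOrthogonal D a L v) :
    SineOrthogonal D a L (fun x => u x + v x) := by
  refine ⟨hu.1.add hv.1, fun f hf l => ?_⟩
  have hc := continuous_tensor hf (sineFun a (freq L l)).continuous
  simp only [add_mul]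
  rw [integral_add (integrableOn_mul_continuous hD hb hu.1 hc)
    (integrableOn_mul_continuous hD hb hv.1 hc), hu.2 f hf l, hv.2 f hf l, add_zero]

lemma SineOrthogonal.const_mul {D : Set (Rn n)} {a L : ℝ} {u : Rn (n + 1) → ℝ}
    (hu : SineOrthogonal D a L u) (r : ℝ) : SineOrthogonal D a L (fun x => r * u x) := by
  refine ⟨hu.1.const_mul r, fun f hf l => ?_⟩
  simp only [mul_assoc]
  rw [integral_const_mul, hu.2 f hf l, mul_zero]

lemma SineOrthogonal.mul_dropLast {D : Set (Rn n)} (hD : IsOpen D) (hb : Bornology.IsBounded D)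
    {a L : ℝ} {u : Rn (n + 1) → ℝ} (hu : SineOrthogonal D a L u) {g : Rn n → ℝ}
    (hg : Continuous g) : SineOrthogonal D a L (fun x => u x * g (dropLast n x)) := by
  refine ⟨integrableOn_mul_continuous hD hb hu.1 (hg.comp (dropLast n).continuous),
    fun f hf l => ?_⟩
  rw [← hu.2 _ (hg.mul hf) l]
  simp only [mul_assoc, Pi.mul_apply]

/-- The function `t ↦ cos (π (t - a) / L)`. -/
def cosFun (a L t : ℝ) : ℝ := Real.cos (freq L 1 * (t - a))

lemma continuous_cosFun (a L : ℝ) : Continuous (cosFun a L) := by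
  unfold cosFun; fun_prop

lemma sineFun_mul_cosFun (a L : ℝ) (l : ℕ) (t : ℝ) :
    cosFun a L t * sineFun a (freq L (l + 1)) t =
      (1 / 2) * sineFun a (freq L (l + 2)) t + (1 / 2) * sineFun a (freq L l) t := by
  have h1 : freq L (l + 2) * (t - a) = freq L (l + 1) * (t - a) + freq L 1 * (t - a) := by
    unfold freq; push_cast; ring
  have h2 : freq L l * (t - a) = freq L (l + 1) * (t - a) - freq L 1 * (t - a) := by
    unfold freq; push_cast; ring
  simp only [sineFun_apply, cosFun, h1, h2, Real.sin_add, Real.sin_sub]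
  ring

/-- The product-to-sum formula keeps cos times a sine inside the span of the sines. The mode l = 0
is identically zero, so the recursion closes at the bottom. -/
lemma SineOrthogonal.mul_cosFun {D : Set (Rn n)} (hD : IsOpen D) (hb : Bornology.IsBounded D)
    {a L : ℝ} {u : Rn (n + 1) → ℝ} (hu : SineOrthogonal D a L u) :
    SineOrthogonal D a L (fun x => u x * cosFun a L (x (Fin.last n))) := by
  refine ⟨integrableOn_mul_continuous hD hb hu.1
    ((continuous_cosFun a L).comp (lastCoord n).continuous), fun f hf l => ?_⟩
  cases l with
  | zero => simp [freq]
  | succ l =>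
    have e : ∀ x : Rn (n + 1), u x * cosFun a L (x (Fin.last n)) *
        (f (dropLast n x) * sineFun a (freq L (l + 1)) (x (Fin.last n))) =
        (1 / 2) * (u x * (f (dropLast n x) * sineFun a (freq L (l + 2)) (x (Fin.last n)))) +
        (1 / 2) * (u x * (f (dropLast n x) * sineFun a (freq L l) (x (Fin.last n)))) := fun x => by
      have := sineFun_mul_cosFun a L l (x (Fin.last n))
      linear_combination (u x * f (dropLast n x)) * this
    simp only [e]
    have hc := fun l => continuous_tensor hf (sineFun a (freq L l)).continuous
    rw [integral_add ((integrableOn_mul_continuous hD hb hu.1 (hc _)).const_mul _)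
      ((integrableOn_mul_continuous hD hb hu.1 (hc _)).const_mul _), integral_const_mul,
      integral_const_mul, hu.2 f hf, hu.2 f hf]
    simp

/-- The coordinate functions of the first `n` coordinates, and the cosine of the last one. -/
def coordCosSet (n : ℕ) (a L : ℝ) : Set C(Rn (n + 1), ℝ) :=
  insert ⟨fun x => cosFun a L (x (Fin.last n)),
      (continuous_cosFun a L).comp (lastCoord n).continuous⟩
    (range fun i : Fin n => ⟨fun x => dropLast n x i,
      (EuclideanSpace.proj (𝕜 := ℝ) i).continuous.comp (dropLast n).continuous⟩)

/-- Orthogonality survives multiplication by each generator. Quantifying over u makes the product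
case a composition. -/
lemma SineOrthogonal.mul_mem_adjoin {D : Set (Rn n)} (hD : IsOpen D) (hb : Bornology.IsBounded D)
    {a L : ℝ} {p : C(Rn (n + 1), ℝ)} (hp : p ∈ Algebra.adjoin ℝ (coordCosSet n a L)) :
    ∀ u : Rn (n + 1) → ℝ, SineOrthogonal D a L u → SineOrthogonal D a L (fun x => u x * p x) := by
  induction hp using Algebra.adjoin_induction with
  | mem p hp =>
    intro u hu
    rcases hp with rfl | ⟨i, rfl⟩
    · exact hu.mul_cosFun hD hb
    · exact hu.mul_dropLast hD hb (g := fun y => y i) (EuclideanSpace.proj (𝕜 := ℝ) i).continuous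
  | algebraMap r =>
    intro u hu
    simpa [mul_comm] using hu.const_mul r
  | add p q _ _ h1 h2 =>
    intro u hu
    simpa [mul_add] using (h1 u hu).add hD hb (h2 u hu)
  | mul p q _ _ h1 h2 =>
    intro u hu
    simpa [mul_assoc] using h2 _ (h1 u hu)

/-- The cosine is injective on [0, π], so a half period distinguishes points of the closed interval;
the coordinates do the rest. -/
lemma separatesPoints_coordCos (D : Set (Rn n)) (a : ℝ) {L : ℝ} (hL : 0 < L) :
    ((Algebra.adjoin ℝ (coordCosSet n a L)).map (ContinuousMap.compRightAlgHom ℝ ℝ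
      (⟨Subtype.val, continuous_subtype_val⟩ :
        C(productDomain (closure D) (Icc a (a + L)), Rn (n + 1))))).SeparatesPoints := by
  rintro ⟨x, hx⟩ ⟨y, hy⟩ hxy
  by_cases hd : dropLast n x = dropLast n y
  · refine ⟨_, ⟨_, ⟨_, Algebra.subset_adjoin (mem_insert _ _), rfl⟩, rfl⟩, ?_⟩
    intro h
    apply hxy
    have hpos : 0 < freq L 1 := by unfold freq; positivity
    have hmem : ∀ z ∈ productDomain (closure D) (Icc a (a + L)),
        freq L 1 * (z (Fin.last n) - a) ∈ Icc 0 Real.pi := fun z hz => by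
      have h1 := hz.2.1
      have h2 := hz.2.2
      have e : freq L 1 * L = Real.pi := by unfold freq; field_simp; simp
      constructor
      · exact mul_nonneg hpos.le (by linarith)
      · rw [← e]
        exact mul_le_mul_of_nonneg_left (by linarith) hpos.le
    have h3 := Real.injOn_cos (hmem x hx) (hmem y hy) h
    have h4 := mul_left_cancel₀ hpos.ne' h3
    ext1
    simp only
    rw [← joinLast_dropLast x, ← joinLast_dropLast y, hd, show x (Fin.last n) = y (Fin.last n) by
      linarith]
  · obtain ⟨i, hi⟩ : ∃ i, dropLast n x i ≠ dropLast n y i := by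
      by_contra! h
      exact hd (by ext i; exact h i)
    exact ⟨_, ⟨_, ⟨_, Algebra.subset_adjoin (mem_insert_of_mem _ ⟨i, rfl⟩), rfl⟩, rfl⟩, hi⟩

/-- For p in the algebra, u p is again orthogonal to the mode l = 1 with f = 1, so ∫ p u sin(π(t -
a)/L) = 0. Stone–Weierstrass on the compact closure extends this to every continuous h. -/
lemma SineOrthogonal.integral_mul_continuous_eq_zero {D : Set (Rn n)} (hD : IsOpen D)
    (hb : Bornology.IsBounded D) {a L : ℝ} (hL : 0 < L) {u : Rn (n + 1) → ℝ}
    (hu : SineOrthogonal D a L u) {h : Rn (n + 1) → ℝ} (hh : Continuous h) :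
    ∫ x in productDomain D (Ioo a (a + L)),
      h x * (u x * sineFun a (freq L 1) (x (Fin.last n))) = 0 := by
  have hK := isCompact_productDomain (n := n) hb.isCompact_closure
    (isCompact_Icc (a := a) (b := a + L))
  have hm := (isOpen_productDomain hD (isOpen_Ioo (a := a) (b := a + L))).measurableSet
  have : CompactSpace (productDomain (closure D) (Icc a (a + L))) := isCompact_iff_compactSpace.1 hK
  have hs : Continuous fun x : Rn (n + 1) => sineFun a (freq L 1) (x (Fin.last n)) :=
    (sineFun a (freq L 1)).continuous.comp (lastCoord n).continuous
  have hui : IntegrableOn (fun x => u x * sineFun a (freq L 1) (x (Fin.last n)))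
    (productDomain D (Ioo a (a + L))) := integrableOn_mul_continuous hD hb hu.1 hs
  set M := ∫ x in productDomain D (Ioo a (a + L)),
    ‖u x * sineFun a (freq L 1) (x (Fin.last n))‖ with hM
  have hM0 : 0 ≤ M := integral_nonneg fun _ => norm_nonneg _
  rw [← norm_le_zero_iff]
  refine le_of_forall_pos_le_add fun ε hε => ?_
  obtain ⟨⟨_, p, hp, rfl⟩, hpn⟩ :=
    ContinuousMap.exists_mem_subalgebra_near_continuousMap_of_separatesPoints _
      (separatesPoints_coordCos D a hL)
      ⟨fun x : productDomain (closure D) (Icc a (a + L)) => h x, hh.comp continuous_subtype_val⟩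
      -- The 1 keeps the quotient meaningful when M = 0.
      (ε / (M + 1)) (by positivity)
  have hnear : ∀ x ∈ productDomain D (Ioo a (a + L)), ‖p x - h x‖ ≤ ε / (M + 1) := fun x hx =>
    (ContinuousMap.norm_coe_le_norm _ (⟨x, productDomain_subset_compact D a (a + L) hx⟩ :
      productDomain (closure D) (Icc a (a + L)))).trans hpn.le
  have hp0 : ∫ x in productDomain D (Ioo a (a + L)),
      p x * (u x * sineFun a (freq L 1) (x (Fin.last n))) = 0 := by
    rw [← (SineOrthogonal.mul_mem_adjoin hD hb hp u hu).2 (fun _ => 1) continuous_const 1]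
    refine integral_congr_ae (Eventually.of_forall fun x => ?_)
    simp only
    ring
  have hI : ∀ g : Rn (n + 1) → ℝ, Continuous g → IntegrableOn
      (fun x => g x * (u x * sineFun a (freq L 1) (x (Fin.last n))))
      (productDomain D (Ioo a (a + L))) := fun g hg => by
    simpa [mul_comm] using integrableOn_mul_continuous hD hb hui hg
  have e : ∫ x in productDomain D (Ioo a (a + L)),
      h x * (u x * sineFun a (freq L 1) (x (Fin.last n))) =
      ∫ x in productDomain D (Ioo a (a + L)),
        (h x - p x) * (u x * sineFun a (freq L 1) (x (Fin.last n))) := by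
    simp only [sub_mul]
    rw [integral_sub (hI h hh) (hI p p.continuous), hp0, sub_zero]
  rw [e, zero_add]
  calc _ ≤ ∫ x in productDomain D (Ioo a (a + L)),
        ε / (M + 1) * ‖u x * sineFun a (freq L 1) (x (Fin.last n))‖ := by
        refine norm_integral_le_of_norm_le (hui.norm.const_mul _) ?_
        filter_upwards [ae_restrict_mem hm] with x hx
        rw [norm_mul, ← norm_neg, neg_sub]
        gcongr
        exact hnear x hx
    _ = ε * (M / (M + 1)) := by rw [integral_const_mul]; ring
    _ ≤ ε * 1 := by
        gcongr
        rw [div_le_one (by positivity)]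
        linarith
    _ = ε := mul_one ε

/-- u times the first sine vanishes almost everywhere, and the first sine is strictly positive
inside the interval. -/
lemma SineOrthogonal.ae_eq_zero {D : Set (Rn n)} (hD : IsOpen D)
    (hb : Bornology.IsBounded D) {a L : ℝ} (hL : 0 < L) {u : Rn (n + 1) → ℝ}
    (hu : SineOrthogonal D a L u) :
    u =ᵐ[volume.restrict (productDomain D (Ioo a (a + L)))] 0 := by
  have ho := isOpen_productDomain hD (isOpen_Ioo (a := a) (b := a + L))
  have hs : Continuous fun x : Rn (n + 1) => sineFun a (freq L 1) (x (Fin.last n)) :=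
    (sineFun a (freq L 1)).continuous.comp (lastCoord n).continuous
  have hui : IntegrableOn (fun x => u x * sineFun a (freq L 1) (x (Fin.last n)))
    (productDomain D (Ioo a (a + L))) := integrableOn_mul_continuous hD hb hu.1 hs
  have h := ho.ae_eq_zero_of_integral_contDiff_smul_eq_zero (μ := volume)
    hui.locallyIntegrableOn fun g hg _ hgs => by
      rw [← setIntegral_eq_integral_of_forall_compl_eq_zero
        (s := productDomain D (Ioo a (a + L)))]
      · exact hu.integral_mul_continuous_eq_zero hD hb hL hg.continuous
      · intro x hx
        rw [image_eq_zero_of_notMem_tsupport fun h => hx (hgs h), zero_smul]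
  filter_upwards [(ae_restrict_iff' ho.measurableSet).2 h, ae_restrict_mem ho.measurableSet]
    with x hx hxm
  have hpos : 0 < freq L 1 := by unfold freq; positivity
  have e : freq L 1 * L = Real.pi := by unfold freq; field_simp; simp
  have h1 := hxm.2.1
  have h2 := hxm.2.2
  have : 0 < sineFun a (freq L 1) (x (Fin.last n)) := by
    apply Real.sin_pos_of_pos_of_lt_pi
    · exact mul_pos hpos (by linarith)
    · rw [← e]
      exact mul_lt_mul_of_pos_left (by linarith) hpos
  exact (mul_eq_zero.1 hx).resolve_right this.ne'

lemma sineOrthogonal_of_adjoint_eq_zero {D : Set (Rn n)} (hD : IsOpen D)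
    (hb : Bornology.IsBounded D) {a L : ℝ} (hJ : volume (Ioo a (a + L)) ≠ ⊤)
    {u : L2Fun (productDomain D (Ioo a (a + L)))}
    (hu : ∀ l : ℕ, ContinuousLinearMap.adjoint (tensorLast D hJ (sineFun a (freq L (l + 1)))
      (ContinuousLinearMap.id ℝ ℝ)) u = 0) : SineOrthogonal D a L u := by
  have hfin : ∀ (k : ℕ) (S : Set (Rn k)), Bornology.IsBounded S →
      IsFiniteMeasure (volume.restrict S) := fun k S hS =>
    ⟨by simpa using hS.measure_lt_top⟩
  have := hfin n D hb
  have := hfin (n + 1) _ ((isCompact_productDomain hb.isCompact_closure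
    (isCompact_Icc (a := a) (b := a + L))).isBounded.subset
      (productDomain_subset_compact D a (a + L)))
  refine ⟨(Lp.memLp u).integrable (by norm_num), fun f hf l => ?_⟩
  cases l with
  | zero => simp [freq]
  | succ l =>
    obtain ⟨C, hC⟩ := hb.isCompact_closure.exists_bound_of_continuousOn hf.continuousOn
    have hfm : MemLp f 2 (volume.restrict D) := by
      refine MemLp.of_bound hf.aestronglyMeasurable C ?_
      filter_upwards [ae_restrict_mem hD.measurableSet] with y hy
      exact hC y (subset_closure hy)
    have h := congrArg (fun v => inner ℝ v (hfm.toLp f)) (hu l)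
    simp only [ContinuousLinearMap.adjoint_inner_left, inner_zero_left] at h
    rw [L2.inner_def] at h
    rw [← h]
    refine integral_congr_ae ?_
    filter_upwards [coeFn_tensorLast_of_ae hJ (sineFun a (freq L (l + 1)))
      (ContinuousLinearMap.id ℝ ℝ) hfm.coeFn_toLp] with x hx
    rw [hx]
    simp only [ContinuousLinearMap.id_apply, smul_eq_mul, RCLike.inner_apply, conj_trivial]
    ring

/-- A function on `D × (a, a + L)` is zero if all its partial sine coefficients are. -/
lemma eq_zero_of_adjoint_tensorLast_eq_zero {D : Set (Rn n)} (hD : IsOpen D)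
    (hb : Bornology.IsBounded D) {a L : ℝ} (hL : 0 < L) (hJ : volume (Ioo a (a + L)) ≠ ⊤)
    {u : L2Fun (productDomain D (Ioo a (a + L)))}
    (hu : ∀ l : ℕ, ContinuousLinearMap.adjoint (tensorLast D hJ (sineFun a (freq L (l + 1)))
      (ContinuousLinearMap.id ℝ ℝ)) u = 0) : u = 0 := by
  rw [Lp.eq_zero_iff_ae_eq_zero]
  exact (sineOrthogonal_of_adjoint_eq_zero hD hb hJ hu).ae_eq_zero hD hb hL

end SineOrthogonal

/-! ### The counting function of a product -/

/-- The multiplicity of `lam` as a Dirichlet eigenvalue. -/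
def dirichletMult {k : ℕ} (Ω : Set (Rn k)) (lam : ℝ) : ℝ≥0∞ :=
  ((Cardinal.toENat (Module.rank ℝ (dirichletEigenspace Ω lam)) : ℕ∞) : ℝ≥0∞)

lemma dirichletCount_eq_tsum_indicator {k : ℕ} (Ω : Set (Rn k)) (μ : ℝ) :
    dirichletCount Ω μ = ∑' lam : ℝ, (Iic (μ ^ 2)).indicator (dirichletMult Ω) lam :=
  tsum_subtype (Iic (μ ^ 2)) (dirichletMult Ω)

lemma toENat_rank_pi (m : ℕ) : ∀ {E : Fin m → Type} [∀ i, AddCommGroup (E i)]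
    [∀ i, Module ℝ (E i)],
    Cardinal.toENat (Module.rank ℝ (∀ i, E i)) = ∑ i, Cardinal.toENat (Module.rank ℝ (E i)) := by
  induction m with
  | zero => intro E _ _; simp
  | succ m ih =>
    intro E _ _
    rw [← (Fin.consLinearEquiv ℝ E).rank_eq, rank_prod', map_add, ih, Fin.sum_univ_succ]

lemma dirichletEigenspace_eq_bot_of_mult {k : ℕ} {Ω : Set (Rn k)} {lam : ℝ}
    (h : dirichletMult Ω lam = 0) : dirichletEigenspace Ω lam = ⊥ := by
  unfold dirichletMult at h
  have h2 : Cardinal.toENat (Module.rank ℝ (dirichletEigenspace Ω lam)) = 0 := by exact_mod_cast h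
  rw [Cardinal.toENat_eq_zero] at h2
  rwa [Submodule.rank_eq_zero] at h2

/-- Pólya's inequality at `μ = 0` excludes eigenvalues that are not positive. -/
lemma DirichletPolya.eigenspace_eq_bot {k : ℕ} (hk : k ≠ 0) {Ω : Set (Rn k)}
    (h : DirichletPolya Ω) {lam : ℝ} (hlam : lam ≤ 0) : dirichletEigenspace Ω lam = ⊥ := by
  apply dirichletEigenspace_eq_bot_of_mult
  have h0 := h 0 le_rfl
  rw [zero_pow hk, mul_zero, EReal.coe_zero, ← EReal.coe_ennreal_zero,
    EReal.coe_ennreal_le_coe_ennreal_iff, nonpos_iff_eq_zero, dirichletCount_eq_tsum_indicator,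
    ENNReal.tsum_eq_zero] at h0
  have := h0 lam
  rwa [indicator_of_mem (by simpa using hlam)] at this

/-- The first m sine coefficients embed the eigenspace into a finite product of eigenspaces of D:
the later coefficients lie in eigenspaces for numbers ≤ 0, which are trivial, so completeness gives
injectivity. -/
lemma dirichletMult_product_le {n : ℕ} {D : Set (Rn n)} (hD : IsOpen D)
    (hb : Bornology.IsBounded D) {a L : ℝ} (hL : 0 < L)
    (hbot : ∀ lam ≤ 0, dirichletEigenspace D lam = ⊥) {lam : ℝ} {m : ℕ}
    (hm : lam ≤ freq L (m + 1) ^ 2) :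
    dirichletMult (productDomain D (Ioo a (a + L))) lam ≤
      ∑ l : Fin m, dirichletMult D (lam - freq L (l + 1) ^ 2) := by
  have hJ : volume (Ioo a (a + L)) ≠ ⊤ := by simp
  have hab : a < a + L := by linarith
  let T : ℕ → L2Fun (productDomain D (Ioo a (a + L))) →L[ℝ] L2Fun D := fun l =>
    ContinuousLinearMap.adjoint (tensorLast D hJ (sineFun a (freq L (l + 1)))
      (ContinuousLinearMap.id ℝ ℝ))
  have hT : ∀ l, ∀ u ∈ dirichletEigenspace (productDomain D (Ioo a (a + L))) lam,
      T l u ∈ dirichletEigenspace D (lam - freq L (l + 1) ^ 2) := fun l u hu =>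
    adjoint_tensorLast_mem_dirichletEigenspace hD hab hJ (contDiff_sineFun _ _)
      (hasDerivAt_sineFun _ _) (hasDerivAt_sineFunDeriv _ _) (sineFun_freq_left _ _)
      (sineFun_freq_right a hL _) hu
  let Φ : dirichletEigenspace (productDomain D (Ioo a (a + L))) lam →ₗ[ℝ]
      (∀ l : Fin m, dirichletEigenspace D (lam - freq L (l + 1) ^ 2)) :=
    LinearMap.pi fun l => ((T l).toLinearMap.restrict (hT l))
  have hΦ : Function.Injective Φ := by
    rw [← LinearMap.ker_eq_bot, LinearMap.ker_eq_bot']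
    rintro ⟨u, hu⟩ h
    ext1
    refine eq_zero_of_adjoint_tensorLast_eq_zero hD hb hL hJ fun l => ?_
    by_cases hl : l < m
    · have := congrArg Subtype.val (congrFun h ⟨l, hl⟩)
      exact this
    · have h1 := hT l u hu
      rw [hbot, Submodule.mem_bot] at h1
      · exact h1
      · have : freq L (m + 1) ≤ freq L (l + 1) := by
          unfold freq
          have : (m : ℝ) ≤ l := by exact_mod_cast not_lt.1 hl
          push_cast
          gcongr
        have h0 : 0 ≤ freq L (m + 1) := by unfold freq; positivity
        nlinarith
  have h1 := LinearMap.rank_le_of_injective Φ hΦ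
  have h2 := Cardinal.toENat.monotone' h1
  have h3 : Cardinal.toENat (Module.rank ℝ
      (dirichletEigenspace (productDomain D (Ioo a (a + L))) lam)) ≤
      ∑ l : Fin m, Cardinal.toENat (Module.rank ℝ
        (dirichletEigenspace D (lam - freq L (l + 1) ^ 2))) := by
    rw [← toENat_rank_pi]
    exact h2
  unfold dirichletMult
  exact (ENat.toENNReal_le.2 h3).trans_eq (map_sum ENat.toENNRealRingHom _ _)

lemma tsum_indicator_sub {k : ℕ} (Ω : Set (Rn k)) (M c : ℝ) :
    ∑' lam : ℝ, (Iic M).indicator (fun lam => dirichletMult Ω (lam - c)) lam =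
      ∑' lam : ℝ, (Iic (M - c)).indicator (dirichletMult Ω) lam := by
  rw [← (Equiv.subRight c).tsum_eq (fun lam => (Iic (M - c)).indicator (dirichletMult Ω) lam)]
  refine tsum_congr fun lam => ?_
  by_cases h : lam ≤ M
  · rw [indicator_of_mem (by simpa using h), indicator_of_mem (by simpa using h)]
    rfl
  · rw [indicator_of_notMem (by simpa using h), indicator_of_notMem (by simpa using h)]

/-- The counting function of a product is bounded by a sum of counting functions of the base. -/
lemma dirichletCount_product_le {n : ℕ} {D : Set (Rn n)} (hD : IsOpen D)
    (hb : Bornology.IsBounded D) {a L : ℝ} (hL : 0 < L)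
    (hbot : ∀ lam ≤ 0, dirichletEigenspace D lam = ⊥) {μ : ℝ} {m : ℕ}
    (hm : μ ^ 2 ≤ freq L (m + 1) ^ 2) (hm' : ∀ l ≤ m, freq L l ^ 2 ≤ μ ^ 2) :
    dirichletCount (productDomain D (Ioo a (a + L))) μ ≤
      ∑ l : Fin m, dirichletCount D √(μ ^ 2 - freq L (l + 1) ^ 2) := by
  simp only [dirichletCount_eq_tsum_indicator]
  calc _ ≤ ∑' lam : ℝ, ∑ l : Fin m,
        (Iic (μ ^ 2)).indicator (fun lam => dirichletMult D (lam - freq L (l + 1) ^ 2)) lam := by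
        refine ENNReal.tsum_le_tsum fun lam => ?_
        by_cases h : lam ≤ μ ^ 2
        · simp only [indicator_of_mem (show lam ∈ Iic (μ ^ 2) from h)]
          exact dirichletMult_product_le hD hb hL hbot (h.trans hm)
        · rw [indicator_of_notMem (by simpa using h)]
          exact zero_le
    _ = ∑ l : Fin m, ∑' lam : ℝ,
        (Iic (μ ^ 2)).indicator (fun lam => dirichletMult D (lam - freq L (l + 1) ^ 2)) lam :=
        Summable.tsum_finsetSum fun _ _ => ENNReal.summable
    _ = _ := by
        refine Finset.sum_congr rfl fun l _ => ?_
        rw [tsum_indicator_sub, Real.sq_sqrt]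
        exact sub_nonneg.2 (hm' _ l.2)

lemma DirichletPolya.le_ofReal {k : ℕ} {Ω : Set (Rn k)} (h : DirichletPolya Ω) {μ : ℝ}
    (hμ : 0 ≤ μ) : dirichletCount Ω μ ≤
      ENNReal.ofReal (unitBallVolume k / (2 * Real.pi) ^ k * volume.real Ω * μ ^ k) := by
  have h1 := h μ hμ
  rw [← EReal.coe_ennreal_le_coe_ennreal_iff, EReal.coe_ennreal_ofReal, max_eq_left]
  · exact h1
  · have : 0 ≤ unitBallVolume k := measureReal_nonneg
    positivity

/-- The bound for the counting function of a product that follows from Pólya's inequality for the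
base. -/
lemma DirichletPolya.product_le {n : ℕ} (hn : n ≠ 0) {D : Set (Rn n)} (hD : IsOpen D)
    (hb : Bornology.IsBounded D) (hP : DirichletPolya D) {a L : ℝ} (hL : 0 < L) {μ : ℝ}
    (hμ : 0 ≤ μ) :
    (dirichletCount (productDomain D (Ioo a (a + L))) μ : EReal) ≤
      ((unitBallVolume n / (2 * Real.pi) ^ n * volume.real D *
        ∑ l ∈ Finset.range ⌊L * μ / Real.pi⌋₊, √(μ ^ 2 - freq L (l + 1) ^ 2) ^ n : ℝ) : EReal) := by
  set m := ⌊L * μ / Real.pi⌋₊ with hm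
  have hω : 0 ≤ unitBallVolume n := measureReal_nonneg
  have h1 := dirichletCount_product_le (a := a) hD hb hL (fun lam h => hP.eigenspace_eq_bot hn h)
    (μ := μ) (m := m) (by
      -- By the choice of m as a floor, the frequency with index m + 1 is at least μ, while those up
      -- to m are at most μ.
      have h := (Nat.lt_floor_add_one (L * μ / Real.pi)).le
      rw [div_le_iff₀ Real.pi_pos] at h
      gcongr
      unfold freq
      rw [le_div_iff₀ hL]
      push_cast
      linarith) (fun l hl => by
      have h := (Nat.cast_le (α := ℝ).2 hl).trans (Nat.floor_le (by positivity))
      rw [le_div_iff₀ Real.pi_pos] at h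
      have h0 : 0 ≤ freq L l := by unfold freq; positivity
      gcongr
      unfold freq
      rw [div_le_iff₀ hL]
      linarith)
  have h2 := h1.trans (Finset.sum_le_sum fun l _ => hP.le_ofReal (Real.sqrt_nonneg _))
  rw [← ENNReal.ofReal_sum_of_nonneg (fun l _ => by positivity), ← Finset.mul_sum,
    Fin.sum_univ_eq_sum_range (fun l => √(μ ^ 2 - freq L (l + 1) ^ 2) ^ n)] at h2
  refine (EReal.coe_ennreal_le_coe_ennreal_iff.2 h2).trans_eq ?_
  rw [EReal.coe_ennreal_ofReal, max_eq_left]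
  exact mul_nonneg (by positivity) (Finset.sum_nonneg fun l _ => by positivity)

/-! ### Sums of `√(R² - l²) ^ n` -/

/-- The function `s ↦ (R² - s²)₊ ^ (n / 2)`. -/
def ballProfile (R : ℝ) (n : ℕ) (s : ℝ) : ℝ := √(R ^ 2 - s ^ 2) ^ n

lemma continuous_ballProfile (R : ℝ) (n : ℕ) : Continuous (ballProfile R n) := by
  unfold ballProfile; fun_prop

lemma ballProfile_nonneg (R : ℝ) (n : ℕ) (s : ℝ) : 0 ≤ ballProfile R n s := by
  unfold ballProfile; positivity

lemma ballProfile_eq_zero {R : ℝ} (hR : 0 ≤ R) {n : ℕ} (hn : n ≠ 0) {s : ℝ} (hs : R ≤ |s|) :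
    ballProfile R n s = 0 := by
  have : R ^ 2 - s ^ 2 ≤ 0 := by
    rw [← sq_abs s]
    nlinarith
  -- The square root of a negative number is 0, which supplies the positive part. For n = 0 the
  -- power would be 1 everywhere.
  rw [ballProfile, Real.sqrt_eq_zero_of_nonpos this, zero_pow hn]

lemma ballProfile_abs (R : ℝ) (n : ℕ) (s : ℝ) : ballProfile R n |s| = ballProfile R n s := by
  simp [ballProfile]

lemma ballProfile_antitone (R : ℝ) (n : ℕ) : AntitoneOn (ballProfile R n) (Ici 0) := by
  intro s hs t _ hst
  unfold ballProfile
  have : 0 ≤ s := hs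
  gcongr

lemma integrable_ballProfile {R : ℝ} (hR : 0 ≤ R) {n : ℕ} (hn : n ≠ 0) :
    Integrable (ballProfile R n) := by
  refine (continuous_ballProfile R n).integrable_of_hasCompactSupport ?_
  refine HasCompactSupport.intro (isCompact_Icc (a := -R) (b := R)) fun s hs => ?_
  refine ballProfile_eq_zero hR hn ?_
  by_contra! h
  exact hs (abs_le.1 h.le)

lemma intervalIntegral_ballProfile_le {R : ℝ} (hR : 0 ≤ R) {n : ℕ} (hn : n ≠ 0) {T : ℝ}
    (hT : 0 ≤ T) : ∫ s in (0)..T, ballProfile R n s ≤ ∫ s in Ioi 0, ballProfile R n s := by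
  rw [intervalIntegral.integral_of_le hT]
  exact setIntegral_mono_set (integrable_ballProfile hR hn).integrableOn
    (Eventually.of_forall fun s => ballProfile_nonneg R n s) Ioc_subset_Ioi_self.eventuallyLE

/-- The volume of the ball, by integration over slices. -/
lemma unitBallVolume_succ {n : ℕ} (hn : n ≠ 0) {R : ℝ} (hR : 0 ≤ R) :
    unitBallVolume (n + 1) * R ^ (n + 1) =
      2 * unitBallVolume n * ∫ s in Ioi 0, ballProfile R n s := by
  have := NeZero.mk hn
  have h1 : volume.real (Metric.ball (0 : Rn (n + 1)) R) =
      unitBallVolume (n + 1) * R ^ (n + 1) := by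
    rw [Measure.real, Measure.addHaar_ball _ _ hR]
    simp [unitBallVolume, Measure.real, hR, mul_comm]
  have hslice : Metric.ball (0 : Rn (n + 1)) R =
      splitLast n ⁻¹' {p | ‖p.1‖ ^ 2 + p.2 ^ 2 < R ^ 2} := by
    ext x
    have : ‖x‖ ^ 2 = ‖dropLast n x‖ ^ 2 + x (Fin.last n) ^ 2 := by
      simp [EuclideanSpace.norm_sq_eq, Fin.sum_univ_castSucc]
    rw [mem_ball_zero_iff, mem_preimage, mem_ofPred_eq, splitLast_apply, ← this,
      sq_lt_sq₀ (norm_nonneg _) hR]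
  have hmeas : MeasurableSet {p : Rn n × ℝ | ‖p.1‖ ^ 2 + p.2 ^ 2 < R ^ 2} :=
    (isOpen_lt (by fun_prop) continuous_const).measurableSet
  have hball : ∀ t : ℝ, volume ((fun y : Rn n => (y, t)) ⁻¹'
      {p : Rn n × ℝ | ‖p.1‖ ^ 2 + p.2 ^ 2 < R ^ 2}) =
      ENNReal.ofReal (ballProfile R n t) * volume (Metric.ball (0 : Rn n) 1) := fun t => by
    have : (fun y : Rn n => (y, t)) ⁻¹' {p : Rn n × ℝ | ‖p.1‖ ^ 2 + p.2 ^ 2 < R ^ 2} =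
        Metric.ball 0 √(R ^ 2 - t ^ 2) := by
      ext y
      rw [mem_ball_zero_iff, Real.lt_sqrt (norm_nonneg _), mem_preimage, mem_ofPred_eq,
        lt_sub_iff_add_lt]
    rw [this, Measure.addHaar_ball _ _ (Real.sqrt_nonneg _)]
    simp [ballProfile]
  rw [← h1, hslice, Measure.real, (volume_preserving_splitLast n).measure_preimage_equiv,
    Measure.volume_eq_prod, Measure.prod_apply_symm hmeas]
  simp only [hball]
  rw [lintegral_mul_const _ (by
      exact ENNReal.measurable_ofReal.comp (continuous_ballProfile R n).measurable),
    ← ofReal_integral_eq_lintegral_ofReal (integrable_ballProfile hR hn)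
      (Eventually.of_forall fun s => ballProfile_nonneg R n s), ENNReal.toReal_mul,
    ENNReal.toReal_ofReal (integral_nonneg fun s => ballProfile_nonneg R n s)]
  -- The profile is even, whence the factor 2.
  have habs := integral_comp_abs (f := ballProfile R n)
  simp only [ballProfile_abs] at habs
  rw [habs, unitBallVolume, Measure.real]
  ring

/-! ### Concavity and convexity of the profile -/

/-- Putting the derivative under one root makes its monotonicity that of the polynomial y(c -
y)^(n-2) at y = s², c = R². -/
lemma hasDerivAt_ballProfile {R : ℝ} {n : ℕ} (hn : 2 ≤ n) {s : ℝ} (hs0 : 0 ≤ s) (hs : s < R) :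
    HasDerivAt (ballProfile R n) (-(n * √(s ^ 2 * (R ^ 2 - s ^ 2) ^ (n - 2)))) s := by
  have hpos : 0 < R ^ 2 - s ^ 2 := by nlinarith
  have h1 : HasDerivAt (fun s : ℝ => R ^ 2 - s ^ 2) (-(2 * s)) s := by
    simpa using (hasDerivAt_pow 2 s).const_sub (R ^ 2)
  have h2 := (h1.sqrt hpos.ne').pow n
  refine h2.congr_deriv ?_
  obtain ⟨k, rfl⟩ := Nat.exists_eq_add_of_le hn
  have hq := Real.sqrt_pos.2 hpos
  have e : √(s ^ 2 * (R ^ 2 - s ^ 2) ^ k) = s * √(R ^ 2 - s ^ 2) ^ k := by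
    rw [Real.sqrt_mul (sq_nonneg s), Real.sqrt_sq hs0]
    congr 1
    rw [Real.sqrt_eq_iff_mul_self_eq (by positivity) (by positivity), ← mul_pow,
      Real.mul_self_sqrt hpos.le]
  rw [show 2 + k - 2 = k by omega, show 2 + k - 1 = k + 1 by omega, e]
  field_simp
  ring

lemma hasDerivAt_mul_sub_pow (c : ℝ) (k : ℕ) (y : ℝ) :
    HasDerivAt (fun y : ℝ => y * (c - y) ^ (k + 1)) ((c - y) ^ k * (c - (k + 2) * y)) y := by
  have h := (hasDerivAt_id' y).mul (((hasDerivAt_id' y).const_sub c).pow (k + 1))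
  refine h.congr_deriv ?_
  simp
  ring

/-- The turning point c/(k + 2), with k + 2 = n - 1, corresponds to the inflection s = R/√(n - 1).
-/
lemma monotoneOn_mul_sub_pow (c : ℝ) (k : ℕ) :
    MonotoneOn (fun y : ℝ => y * (c - y) ^ (k + 1)) (Icc 0 (c / (k + 2))) := by
  refine monotoneOn_of_deriv_nonneg (convex_Icc _ _) (by fun_prop)
    (fun y _ => (hasDerivAt_mul_sub_pow c k y).differentiableAt.differentiableWithinAt) ?_
  intro y hy
  rw [interior_Icc] at hy
  rw [(hasDerivAt_mul_sub_pow c k y).deriv]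
  have h1 : y * (k + 2) < c := (lt_div_iff₀ (by positivity)).1 hy.2
  have h2 : y ≤ c := by
    have := hy.1
    have : 0 ≤ y * k := by positivity
    nlinarith
  exact mul_nonneg (pow_nonneg (by linarith) _) (by linarith)

lemma antitoneOn_mul_sub_pow (c : ℝ) (k : ℕ) :
    AntitoneOn (fun y : ℝ => y * (c - y) ^ (k + 1)) (Icc (c / (k + 2)) c) := by
  refine antitoneOn_of_deriv_nonpos (convex_Icc _ _) (by fun_prop)
    (fun y _ => (hasDerivAt_mul_sub_pow c k y).differentiableAt.differentiableWithinAt) ?_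
  intro y hy
  rw [interior_Icc] at hy
  rw [(hasDerivAt_mul_sub_pow c k y).deriv]
  have h1 : c < y * (k + 2) := (div_lt_iff₀ (by positivity)).1 hy.1
  exact mul_nonpos_of_nonneg_of_nonpos (pow_nonneg (by linarith [hy.2]) _) (by linarith)

lemma concaveOn_ballProfile {R : ℝ} {n : ℕ} (hn : 3 ≤ n) {r : ℝ} (hr : 0 ≤ r)
    (hrR : r * √((n : ℝ) - 1) ≤ R) : ConcaveOn ℝ (Icc 0 r) (ballProfile R n) := by
  obtain ⟨k, rfl⟩ := Nat.exists_eq_add_of_le hn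
  have hsq : √(((3 + k : ℕ) : ℝ) - 1) ^ 2 = k + 2 := by
    rw [Real.sq_sqrt] <;> push_cast <;> [ring; linarith [k.cast_nonneg (α := ℝ)]]
  have hR2 : r ^ 2 * (k + 2) ≤ R ^ 2 := by
    rw [← hsq, ← mul_pow]
    gcongr
  have hR0 : 0 ≤ R := (by positivity : 0 ≤ r * √(((3 + k : ℕ) : ℝ) - 1)).trans hrR
  have hlt : ∀ s ∈ Ioo 0 r, s < R := fun s hs => by
    refine lt_of_pow_lt_pow_left₀ 2 hR0 ?_
    have h1 : s ^ 2 < r ^ 2 := pow_lt_pow_left₀ hs.2 hs.1.le two_ne_zero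
    have : 0 ≤ r ^ 2 * (k + 1) := by positivity
    nlinarith
  refine AntitoneOn.concaveOn_of_deriv (convex_Icc _ _) (continuous_ballProfile R _).continuousOn
    ?_ ?_
  · intro s hs
    rw [interior_Icc] at hs
    exact (hasDerivAt_ballProfile (by omega) hs.1.le
      (hlt s hs)).differentiableAt.differentiableWithinAt
  · intro s hs t ht hst
    rw [interior_Icc] at hs ht
    rw [(hasDerivAt_ballProfile (by omega) hs.1.le (hlt s hs)).deriv,
      (hasDerivAt_ballProfile (by omega) ht.1.le (hlt t ht)).deriv]
    have hmem : ∀ s ∈ Ioo 0 r, s ^ 2 ∈ Icc 0 (R ^ 2 / (k + 2)) := fun s hs => by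
      refine ⟨sq_nonneg _, ?_⟩
      rw [le_div_iff₀ (by positivity)]
      refine le_trans ?_ hR2
      have := hs.1.le
      have := hs.2.le
      gcongr
    have := monotoneOn_mul_sub_pow (R ^ 2) k (hmem s hs) (hmem t ht)
      (pow_le_pow_left₀ hs.1.le hst 2)
    rw [show 3 + k - 2 = k + 1 by omega]
    exact neg_le_neg (mul_le_mul_of_nonneg_left (Real.sqrt_le_sqrt this) (Nat.cast_nonneg _))

lemma convexOn_ballProfile {R : ℝ} {n : ℕ} (hn : 3 ≤ n) {r : ℝ} (hr : 0 ≤ r)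
    (hrR : R ≤ r * √((n : ℝ) - 1)) : ConvexOn ℝ (Icc r R) (ballProfile R n) := by
  obtain ⟨k, rfl⟩ := Nat.exists_eq_add_of_le hn
  have hsq : √(((3 + k : ℕ) : ℝ) - 1) ^ 2 = k + 2 := by
    rw [Real.sq_sqrt] <;> push_cast <;> [ring; linarith [k.cast_nonneg (α := ℝ)]]
  refine MonotoneOn.convexOn_of_deriv (convex_Icc _ _) (continuous_ballProfile R _).continuousOn
    ?_ ?_
  · intro s hs
    rw [interior_Icc] at hs
    exact (hasDerivAt_ballProfile (by omega) (hr.trans hs.1.le)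
      hs.2).differentiableAt.differentiableWithinAt
  · intro s hs t ht hst
    rw [interior_Icc] at hs ht
    rw [(hasDerivAt_ballProfile (by omega) (hr.trans hs.1.le) hs.2).deriv,
      (hasDerivAt_ballProfile (by omega) (hr.trans ht.1.le) ht.2).deriv]
    have hmem : ∀ s ∈ Ioo r R, s ^ 2 ∈ Icc (R ^ 2 / (k + 2)) (R ^ 2) := fun s hs => by
      have h0 : 0 ≤ s := hr.trans hs.1.le
      refine ⟨?_, pow_le_pow_left₀ h0 hs.2.le 2⟩
      rw [div_le_iff₀ (by positivity), ← hsq, ← mul_pow]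
      have : 0 ≤ R := h0.trans hs.2.le
      refine pow_le_pow_left₀ this (hrR.trans ?_) 2
      gcongr
      exact hs.1.le
    have := antitoneOn_mul_sub_pow (R ^ 2) k (hmem s hs) (hmem t ht)
      (pow_le_pow_left₀ (hr.trans hs.1.le) hst 2)
    rw [show 3 + k - 2 = k + 1 by omega]
    exact neg_le_neg (mul_le_mul_of_nonneg_left (Real.sqrt_le_sqrt this) (Nat.cast_nonneg _))

/-! ### Comparing sums with integrals -/

/-- The trapezoidal rule underestimates the integral of a concave function. -/
lemma ConcaveOn.trapezoid_le_integral {f : ℝ → ℝ} (hf : Continuous f) {a : ℝ}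
    (h : ConcaveOn ℝ (Icc a (a + 1)) f) : (f a + f (a + 1)) / 2 ≤ ∫ s in a..(a + 1), f s := by
  have hline : ∫ s in a..(a + 1), (f a + (s - a) * (f (a + 1) - f a)) =
      (f a + f (a + 1)) / 2 := by
    rw [intervalIntegral.integral_add (by simp) (Continuous.intervalIntegrable (by fun_prop) _ _),
      intervalIntegral.integral_mul_const, intervalIntegral.integral_sub (by simp) (by simp)]
    simp
    ring
  rw [← hline]
  refine intervalIntegral.integral_mono_on (by linarith)
    (Continuous.intervalIntegrable (by fun_prop) _ _) (hf.intervalIntegrable _ _) fun s hs => ?_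
  have := h.2 (left_mem_Icc.2 (by linarith)) (right_mem_Icc.2 (by linarith))
    (show 0 ≤ a + 1 - s by linarith [hs.2]) (show 0 ≤ s - a by linarith [hs.1]) (by ring)
  simp only [smul_eq_mul] at this
  rw [show (a + 1 - s) * a + (s - a) * (a + 1) = s by ring] at this
  linarith

/-- The midpoint rule underestimates the integral of a midpoint convex function. -/
lemma midpoint_le_integral {f : ℝ → ℝ} (hf : Continuous f) {c : ℝ}
    (h : ∀ x ∈ Icc (0 : ℝ) (1 / 2), 2 * f c ≤ f (c - x) + f (c + x)) :
    f c ≤ ∫ s in (c - 1 / 2)..(c + 1 / 2), f s := by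
  have h1 : ∫ s in (c - 1 / 2)..c, f s = ∫ x in (0 : ℝ)..(1 / 2), f (c - x) := by
    rw [intervalIntegral.integral_comp_sub_left]
    simp
  have h2 : ∫ s in c..(c + 1 / 2), f s = ∫ x in (0 : ℝ)..(1 / 2), f (c + x) := by
    rw [intervalIntegral.integral_comp_add_left]
    simp
  rw [← intervalIntegral.integral_add_adjacent_intervals (hf.intervalIntegrable _ c)
    (hf.intervalIntegrable c _), h1, h2, ← intervalIntegral.integral_add
    (Continuous.intervalIntegrable (by fun_prop) _ _)
    (Continuous.intervalIntegrable (by fun_prop) _ _)]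
  have h3 : ∫ x in (0 : ℝ)..(1 / 2), 2 * f c = f c := by simp
  rw [← h3]
  exact intervalIntegral.integral_mono_on (by norm_num) (by simp)
    (Continuous.intervalIntegrable (by fun_prop) _ _) h

lemma antitone_le_integral {f : ℝ → ℝ} (hf : Continuous f) (h : AntitoneOn f (Ici 0)) {a b : ℝ}
    (ha : 0 ≤ a) (hab : a ≤ b) : (b - a) * f b ≤ ∫ s in a..b, f s := by
  have h3 : ∫ x in a..b, f b = (b - a) * f b := by simp
  rw [← h3]
  exact intervalIntegral.integral_mono_on hab (by simp) (hf.intervalIntegrable _ _) fun s hs =>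
    h (ha.trans hs.1) (ha.trans hab) hs.2

/-- The profile is convex on [r, R] and zero beyond R. It joins zero with a corner of the convex
kind, so the midpoint inequality survives across R. -/
lemma ballProfile_midpoint {R : ℝ} {n : ℕ} (hn : 3 ≤ n) {r : ℝ} (hr : 0 ≤ r)
    (hrR : R ≤ r * √((n : ℝ) - 1)) (hR : 0 ≤ R) {c x : ℝ} (hx : 0 ≤ x) (hc : r ≤ c - x) :
    2 * ballProfile R n c ≤ ballProfile R n (c - x) + ballProfile R n (c + x) := by
  have hconv := convexOn_ballProfile hn hr hrR
  have hout : ∀ s, R ≤ s → ballProfile R n s = 0 := fun s hs =>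
    ballProfile_eq_zero hR (by omega) (hs.trans (le_abs_self s))
  have hnn := ballProfile_nonneg R n
  rcases le_or_gt R c with h | h
  · rw [hout c h, mul_zero]
    exact add_nonneg (hnn _) (hnn _)
  rcases le_or_gt (c + x) R with h' | h'
  · have := hconv.2 (x := c - x) (y := c + x) ⟨hc, by linarith⟩ ⟨by linarith, h'⟩
      (show (0 : ℝ) ≤ 1 / 2 by norm_num) (show (0 : ℝ) ≤ 1 / 2 by norm_num) (by norm_num)
    simp only [smul_eq_mul] at this
    rw [show 1 / 2 * (c - x) + 1 / 2 * (c + x) = c by ring] at this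
    linarith
  -- Here c < R < c + x. Write c as a convex combination of c - x and R: the profile vanishes at R,
  -- and the weight of c - x is at most 1/2 because R - c < x.
  · have hd : 0 < x + (R - c) := by linarith
    have := hconv.2 (x := c - x) (y := R) ⟨hc, by linarith⟩ ⟨by linarith, le_rfl⟩
      (show 0 ≤ (R - c) / (x + (R - c)) from div_nonneg (by linarith) hd.le)
      (show 0 ≤ x / (x + (R - c)) from div_nonneg hx hd.le) (by field_simp; ring)
    simp only [smul_eq_mul, hout R le_rfl, mul_zero, add_zero] at this
    rw [show (R - c) / (x + (R - c)) * (c - x) + x / (x + (R - c)) * R = c by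
      field_simp; ring] at this
    have h1 : (R - c) / (x + (R - c)) ≤ 1 / 2 := by
      rw [div_le_iff₀ hd]; linarith
    have h2 := mul_le_mul_of_nonneg_right h1 (hnn (c - x))
    have := hnn (c + x)
    linarith

lemma integral_add_adjacent_ballProfile (R : ℝ) (n : ℕ) (a b c : ℝ) :
    ∫ s in a..c, ballProfile R n s =
      (∫ s in a..b, ballProfile R n s) + ∫ s in b..c, ballProfile R n s :=
  (intervalIntegral.integral_add_adjacent_intervals
    ((continuous_ballProfile R n).intervalIntegrable _ _)
    ((continuous_ballProfile R n).intervalIntegrable _ _)).symm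

lemma sum_ballProfile_le_of_concave {R : ℝ} {n : ℕ} (hn : 3 ≤ n) (σ : ℕ)
    (hσ : σ * √((n : ℝ) - 1) ≤ R) :
    ∑ l ∈ Finset.range σ, ballProfile R n (l + 1) +
      (ballProfile R n 0 - ballProfile R n σ) / 2 ≤ ∫ s in (0)..(σ : ℝ), ballProfile R n s := by
  induction σ with
  | zero => simp
  | succ σ ih =>
    have hle : (σ : ℝ) * √((n : ℝ) - 1) ≤ (σ + 1 : ℕ) * √((n : ℝ) - 1) := by
      gcongr; omega
    have h1 := ih (hle.trans hσ)
    have h2 := ConcaveOn.trapezoid_le_integral (continuous_ballProfile R n) (a := σ)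
      ((concaveOn_ballProfile hn (Nat.cast_nonneg _) hσ).subset
        (Icc_subset_Icc σ.cast_nonneg (by push_cast; rfl)) (convex_Icc _ _))
    rw [Finset.sum_range_succ, integral_add_adjacent_ballProfile R n 0 σ]
    push_cast
    linarith

/-- Beyond σ only monotonicity is used, so the trapezoidal gain is kept unchanged. -/
lemma sum_ballProfile_le {R : ℝ} {n : ℕ} (hn : 3 ≤ n) (σ : ℕ)
    (hσ : σ * √((n : ℝ) - 1) ≤ R) {N : ℕ} (hN : σ ≤ N) :
    ∑ l ∈ Finset.range N, ballProfile R n (l + 1) +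
      (ballProfile R n 0 - ballProfile R n σ) / 2 ≤ ∫ s in (0)..(N : ℝ), ballProfile R n s := by
  induction N, hN using Nat.le_induction with
  | base => exact sum_ballProfile_le_of_concave hn σ hσ
  | succ N _ ih =>
    have h := antitone_le_integral (continuous_ballProfile R n) (ballProfile_antitone R n)
      N.cast_nonneg (show (N : ℝ) ≤ N + 1 by linarith)
    rw [Finset.sum_range_succ, integral_add_adjacent_ballProfile R n 0 N]
    push_cast
    linarith

/-- f(σ + 1) is paid for by [σ, σ + 1], and each later f(l) by the unit interval centred at l. The
half interval [σ + 1, σ + 3/2] is left over and gives the gain f(σ + 2)/2. -/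
lemma sum_ballProfile_le_midpoint {R : ℝ} (hR : 0 ≤ R) {n : ℕ} (hn : 3 ≤ n) (σ : ℕ)
    (hσ : σ * √((n : ℝ) - 1) ≤ R) (hσ' : R ≤ (σ + 1) * √((n : ℝ) - 1)) {N : ℕ} (hN : σ + 1 ≤ N) :
    ∑ l ∈ Finset.range N, ballProfile R n (l + 1) +
      (ballProfile R n 0 - ballProfile R n σ) / 2 + ballProfile R n (σ + 2) / 2 ≤
      ∫ s in (0)..(N + 1 / 2 : ℝ), ballProfile R n s := by
  induction N, hN using Nat.le_induction with
  | base =>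
    have h1 := sum_ballProfile_le_of_concave hn σ hσ
    have h2 := antitone_le_integral (continuous_ballProfile R n) (ballProfile_antitone R n)
      σ.cast_nonneg (show (σ : ℝ) ≤ σ + 1 by linarith)
    have h3 := antitone_le_integral (continuous_ballProfile R n) (ballProfile_antitone R n)
      (show (0 : ℝ) ≤ σ + 1 by positivity) (show (σ + 1 : ℝ) ≤ σ + 1 + 1 / 2 by linarith)
    have h4 : ballProfile R n (σ + 2) ≤ ballProfile R n (σ + 1 + 1 / 2) :=
      ballProfile_antitone R n (mem_Ici.2 (by positivity)) (mem_Ici.2 (by positivity))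
        (by linarith)
    rw [Finset.sum_range_succ, integral_add_adjacent_ballProfile R n 0 σ,
      integral_add_adjacent_ballProfile R n σ (σ + 1)]
    push_cast
    linarith
  | succ N hN ih =>
    have hN' : (σ : ℝ) + 1 ≤ N := by exact_mod_cast hN
    have h := midpoint_le_integral (continuous_ballProfile R n) (c := N + 1) fun x hx =>
      ballProfile_midpoint hn (by positivity) hσ' hR hx.1 (by linarith [hx.2])
    rw [show (N : ℝ) + 1 - 1 / 2 = N + 1 / 2 by ring] at h
    rw [Finset.sum_range_succ, integral_add_adjacent_ballProfile R n 0 (N + 1 / 2)]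
    push_cast
    linarith

/-! ### Explicit lower bounds for the trapezoidal gain -/

/-- An upper Taylor bound for `(1 - x) ^ (n / 2)` if `n ≥ 4`. -/
lemma sqrt_one_sub_pow_le {n : ℕ} (hn : 4 ≤ n) {x : ℝ} (hx : 0 ≤ x) (hx1 : x ≤ 1) :
    √(1 - x) ^ n ≤ 1 - n / 2 * x + n * (n - 2) / 8 * x ^ 2 := by
  have hsq : √(1 - x) ^ 2 = 1 - x := Real.sq_sqrt (by linarith)
  induction n using Nat.strong_induction_on with
  | _ n ih =>
    obtain rfl | rfl | h : n = 4 ∨ n = 5 ∨ 6 ≤ n := by omega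
    · rw [show √(1 - x) ^ 4 = (√(1 - x) ^ 2) ^ 2 by ring, hsq]
      push_cast
      linarith
    · refine le_of_sq_le_sq ?_ ?_
      · rw [show (√(1 - x) ^ 5) ^ 2 = (√(1 - x) ^ 2) ^ 5 by ring, hsq]
        push_cast
        -- After squaring, the difference is x³(x² - (95/64)x + 5/8); 95/128 completes the square.
        nlinarith [mul_nonneg (pow_nonneg hx 3) (sq_nonneg (x - 95 / 128)), pow_nonneg hx 3]
      · push_cast
        nlinarith [sq_nonneg (x - 2 / 3)]
    · obtain ⟨k, rfl⟩ := Nat.exists_eq_add_of_le' (show 2 ≤ n by omega)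
      have := ih k (by omega) (by omega)
      rw [pow_add, hsq]
      have hk : (4 : ℝ) ≤ k := by exact_mod_cast (by omega : 4 ≤ k)
      have h2 := mul_le_mul_of_nonneg_right this (sub_nonneg.2 hx1)
      refine h2.trans ?_
      -- Multiplying the bound for k by 1 - x gives the bound for k + 2 minus exactly this term.
      have : 0 ≤ k * (k - 2) / 8 * x ^ 3 := by
        have : (0 : ℝ) ≤ k - 2 := by linarith
        positivity
      push_cast
      nlinarith

/-- The Taylor coefficient 3/8 would fail: at x = 1 it gives -1/8. With coefficient 1 the difference
of the squares is x²((1 - x)² + 1/4). This is the source of A₁ = 2/3 for d = 4. -/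
lemma sqrt_one_sub_pow_three_le {x : ℝ} (hx1 : x ≤ 1) :
    √(1 - x) ^ 3 ≤ 1 - 3 / 2 * x + x ^ 2 := by
  have hsq : √(1 - x) ^ 2 = 1 - x := Real.sq_sqrt (by linarith)
  refine le_of_sq_le_sq ?_ ?_
  · rw [show (√(1 - x) ^ 3) ^ 2 = (√(1 - x) ^ 2) ^ 3 by ring, hsq]
    nlinarith [mul_nonneg (sq_nonneg x) (sq_nonneg (1 - x)), sq_nonneg x]
  · nlinarith [sq_nonneg (x - 3 / 4)]

/-! ### The improved bounds -/

lemma sqrt_sub_freq_sq {L : ℝ} (hL : 0 < L) (μ : ℝ) (n l : ℕ) :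
    √(μ ^ 2 - freq L (l + 1) ^ 2) ^ n =
      (Real.pi / L) ^ n * ballProfile (L * μ / Real.pi) n (l + 1) := by
  have hπ := Real.pi_pos
  have h : μ ^ 2 - freq L (l + 1) ^ 2 =
      (Real.pi / L) ^ 2 * ((L * μ / Real.pi) ^ 2 - (l + 1) ^ 2) := by
    unfold freq; push_cast; field_simp
  rw [h, Real.sqrt_mul (sq_nonneg _), Real.sqrt_sq (by positivity), mul_pow, ballProfile]

/-- The leading Weyl term of a product, as an integral. -/
lemma weyl_term_eq {n : ℕ} (hn : n ≠ 0) {L : ℝ} (hL : 0 < L) (A : ℝ) {μ : ℝ} (hμ : 0 ≤ μ) :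
    unitBallVolume (n + 1) / (2 * Real.pi) ^ (n + 1) * (A * L) * μ ^ (n + 1) =
      unitBallVolume n / (2 * Real.pi) ^ n * A * ((Real.pi / L) ^ n *
        ∫ s in Ioi 0, ballProfile (L * μ / Real.pi) n s) := by
  have hπ := Real.pi_pos
  have h := unitBallVolume_succ hn (R := L * μ / Real.pi) (by positivity)
  set J := ∫ s in Ioi 0, ballProfile (L * μ / Real.pi) n s
  have e : μ ^ (n + 1) = (L * μ / Real.pi) ^ (n + 1) * (Real.pi / L) ^ (n + 1) := by
    rw [← mul_pow]
    congr 1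
    field_simp
  calc _ = (unitBallVolume (n + 1) * (L * μ / Real.pi) ^ (n + 1)) *
        (A * L * (Real.pi / L) ^ (n + 1) / (2 * Real.pi) ^ (n + 1)) := by rw [e]; ring
    _ = _ := by
      rw [h, pow_succ, pow_succ]
      field_simp

lemma unitBallVolume_nonneg (k : ℕ) : 0 ≤ unitBallVolume k := measureReal_nonneg

lemma unitBallVolume_two : unitBallVolume 2 = Real.pi := by
  simp [unitBallVolume, Measure.real, EuclideanSpace.volume_ball_fin_two, Real.pi_pos.le]

lemma unitBallVolume_three : unitBallVolume 3 = 4 / 3 * Real.pi := by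
  rw [unitBallVolume, Measure.real, EuclideanSpace.volume_ball_fin_three]
  rw [ENNReal.ofReal_one, one_pow, one_mul, ENNReal.toReal_ofReal (by positivity)]
  ring

lemma sum_sq_sub_sq (R : ℝ) (m : ℕ) : ∑ l ∈ Finset.range m, (R ^ 2 - ((l : ℝ) + 1) ^ 2) =
    m * R ^ 2 - m * (m + 1) * (2 * m + 1) / 6 := by
  induction m with
  | zero => simp
  | succ m ih =>
    rw [Finset.sum_range_succ, ih]
    push_cast
    ring

/-- The elementary estimate behind the bound in dimension three. -/
lemma sum_le_boundThree {L : ℝ} (hL : 0 < L) {A : ℝ} (hA : 0 ≤ A) {μ : ℝ} (hμ : 0 ≤ μ) :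
    unitBallVolume 2 / (2 * Real.pi) ^ 2 * A *
      ∑ l ∈ Finset.range ⌊L * μ / Real.pi⌋₊, √(μ ^ 2 - freq L (l + 1) ^ 2) ^ 2 ≤
      boundThree (A * L) L μ := by
  have hπ := Real.pi_pos
  set R := L * μ / Real.pi with hR
  have hR0 : 0 ≤ R := by positivity
  set m := ⌊R⌋₊ with hm
  have hmR : (m : ℝ) ≤ R := Nat.floor_le hR0
  have hfl : ((⌊R⌋ : ℤ) : ℝ) = m := by
    rw [hm, natCast_floor_eq_intCast_floor hR0]
  have hμR : μ = Real.pi / L * R := by rw [hR]; field_simp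
  have hsum : ∑ l ∈ Finset.range m, √(μ ^ 2 - freq L (l + 1) ^ 2) ^ 2 =
      (Real.pi / L) ^ 2 * (m * R ^ 2 - m * (m + 1) * (2 * m + 1) / 6) := by
    rw [← sum_sq_sub_sq, Finset.mul_sum]
    refine Finset.sum_congr rfl fun l hl => ?_
    rw [sqrt_sub_freq_sq hL, ballProfile, Real.sq_sqrt]
    have h1 : (l : ℝ) + 1 ≤ m := by exact_mod_cast Finset.mem_range.1 hl
    have h2 : (0 : ℝ) ≤ l := l.cast_nonneg
    nlinarith
  rw [hsum, boundThree, ← hR, hfl, unitBallVolume_two, unitBallVolume_three, hμR]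
  have key : 0 ≤ (R - m) ^ 2 * (2 * R + m) := by positivity
  -- The difference between the bound and the sum is an exact multiple of (R - m)²(2R + m).
  have e : 4 / 3 * Real.pi / (2 * Real.pi) ^ 3 * (A * L) * (Real.pi / L * R) ^ 3 -
      Real.pi * (A * L) / (8 * L ^ 3) * m * (m + 1 / 3) -
      Real.pi / (2 * Real.pi) ^ 2 * A *
        ((Real.pi / L) ^ 2 * (m * R ^ 2 - m * (m + 1) * (2 * m + 1) / 6)) =
      Real.pi * A / (12 * L ^ 2) * ((R - m) ^ 2 * (2 * R + m)) := by
    field_simp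
    ring
  have : 0 ≤ Real.pi * A / (12 * L ^ 2) * ((R - m) ^ 2 * (2 * R + m)) := by positivity
  linarith

lemma sqrt_one_sub_pow_le_constA₁ {n : ℕ} (hn : 3 ≤ n) {x : ℝ} (hx : 0 ≤ x) (hx1 : x ≤ 1) :
    √(1 - x) ^ n ≤ 1 - n / 2 * x * (1 - constA₁ (n + 1) * x) := by
  rcases hn.eq_or_lt with rfl | hn
  · have h : constA₁ (3 + 1) = 2 / 3 := by norm_num [constA₁]
    rw [h]
    refine (sqrt_one_sub_pow_three_le hx1).trans_eq ?_
    push_cast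
    ring
  · have h : constA₁ (n + 1) = (n - 2) / 4 := by
      rw [constA₁, if_pos (by omega)]
      push_cast
      ring
    rw [h]
    refine (sqrt_one_sub_pow_le hn hx hx1).trans_eq ?_
    ring

lemma ballProfile_eq_mul_pow {R : ℝ} (hR : 0 < R) (n : ℕ) (s : ℝ) :
    ballProfile R n s = √(1 - (s / R) ^ 2) ^ n * R ^ n := by
  have : R ^ 2 - s ^ 2 = (1 - (s / R) ^ 2) * R ^ 2 := by field_simp
  rw [ballProfile, this, Real.sqrt_mul' _ (sq_nonneg R), Real.sqrt_sq hR.le, mul_pow]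

/-- Apply the Taylor-type bound at x = (σ/R)². When R = 0 also σ = 0, and both sides vanish. -/
lemma trapezoid_gain_ge {n : ℕ} (hn : 3 ≤ n) {R : ℝ} (hR : 0 ≤ R) {σ : ℕ} (hσ : (σ : ℝ) ≤ R) :
    n / 4 * (σ / R) ^ 2 * (1 - constA₁ (n + 1) * (σ / R) ^ 2) * R ^ n ≤
      (ballProfile R n 0 - ballProfile R n σ) / 2 := by
  rcases hR.eq_or_lt with rfl | hR
  · have : σ = 0 := by
      have := σ.cast_nonneg (α := ℝ)
      exact_mod_cast le_antisymm hσ this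
    simp [this]
  · have h1 : (σ : ℝ) / R ≤ 1 := (div_le_one hR).2 hσ
    have h := sqrt_one_sub_pow_le_constA₁ hn (sq_nonneg ((σ : ℝ) / R))
      (pow_le_one₀ (by positivity) h1)
    rw [ballProfile_eq_mul_pow hR, ballProfile_eq_mul_pow hR]
    have h2 := mul_le_mul_of_nonneg_right h (pow_pos hR n).le
    simp only [zero_div]
    norm_num
    linarith

lemma boundHigh_eq {n : ℕ} (hn : 3 ≤ n) {L : ℝ} (hL : 0 < L) (A : ℝ) {μ : ℝ} (hμ : 0 ≤ μ) :
    boundHigh (n + 1) (A * L) L μ =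
      unitBallVolume n / (2 * Real.pi) ^ n * A * ((Real.pi / L) ^ n *
        ((∫ s in Ioi 0, ballProfile (L * μ / Real.pi) n s) -
          n / 4 * (floorSigma (n + 1) L μ / (L * μ / Real.pi)) ^ 2 *
          (1 - constA₁ (n + 1) * (floorSigma (n + 1) L μ / (L * μ / Real.pi)) ^ 2) *
          (L * μ / Real.pi) ^ n)) := by
  have hπ := Real.pi_pos
  have e : μ ^ n = (Real.pi / L) ^ n * (L * μ / Real.pi) ^ n := by
    rw [← mul_pow]
    congr 1
    field_simp
  have e2 : Real.pi / (L * μ) * (floorSigma (n + 1) L μ : ℝ) =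
      floorSigma (n + 1) L μ / (L * μ / Real.pi) := by
    rw [div_div_eq_mul_div]
    ring
  rw [boundHigh, weyl_term_eq (by omega) hL A hμ, Nat.add_sub_cancel, e2, e]
  push_cast
  field_simp
  ring

lemma floorSigma_eq {n : ℕ} {L : ℝ} (hL : 0 < L) {μ : ℝ} (hμ : 0 ≤ μ) :
    ∃ σ : ℕ, ((floorSigma (n + 1) L μ : ℤ) : ℝ) = σ ∧
      σ = ⌊L * μ / Real.pi / √((n : ℝ) - 1)⌋₊ := by
  have hπ := Real.pi_pos
  refine ⟨_, ?_, rfl⟩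
  rw [natCast_floor_eq_intCast_floor (by positivity), floorSigma, div_div]
  push_cast
  congr 5
  ring

lemma one_lt_sqrt_cast_sub_one {n : ℕ} (hn : 3 ≤ n) : 1 < √((n : ℝ) - 1) := by
  have : (3 : ℝ) ≤ n := by exact_mod_cast hn
  rw [Real.lt_sqrt] <;> linarith

lemma sum_sqrt_le {n : ℕ} {L : ℝ} (hL : 0 < L) {A : ℝ} (hA : 0 ≤ A) (μ : ℝ) {m : ℕ} {B : ℝ}
    (h : ∑ l ∈ Finset.range m, ballProfile (L * μ / Real.pi) n (l + 1) ≤ B) :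
    unitBallVolume n / (2 * Real.pi) ^ n * A *
      ∑ l ∈ Finset.range m, √(μ ^ 2 - freq L (l + 1) ^ 2) ^ n ≤
      unitBallVolume n / (2 * Real.pi) ^ n * A * ((Real.pi / L) ^ n * B) := by
  have hπ := Real.pi_pos
  have := unitBallVolume_nonneg n
  simp only [sqrt_sub_freq_sq hL]
  rw [← Finset.mul_sum]
  gcongr

/-- The estimate of the lattice sum behind the bound in dimensions `d ≥ 4`. -/
lemma sum_le_boundHigh {n : ℕ} (hn : 3 ≤ n) {L : ℝ} (hL : 0 < L) {A : ℝ} (hA : 0 ≤ A) {μ : ℝ}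
    (hμ : 0 ≤ μ) :
    unitBallVolume n / (2 * Real.pi) ^ n * A *
      ∑ l ∈ Finset.range ⌊L * μ / Real.pi⌋₊, √(μ ^ 2 - freq L (l + 1) ^ 2) ^ n ≤
      boundHigh (n + 1) (A * L) L μ := by
  have hπ := Real.pi_pos
  obtain ⟨σ, hσe, hσ⟩ := floorSigma_eq (n := n) hL hμ
  rw [boundHigh_eq hn hL A hμ, hσe]
  refine sum_sqrt_le hL hA μ ?_
  set R := L * μ / Real.pi with hR
  have hR0 : 0 ≤ R := by positivity
  have h1 := one_lt_sqrt_cast_sub_one hn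
  have hσR : (σ : ℝ) ≤ R / √((n : ℝ) - 1) := by
    rw [hσ]; exact Nat.floor_le (by positivity)
  have hσR' : (σ : ℝ) * √((n : ℝ) - 1) ≤ R := (le_div_iff₀ (by linarith)).1 hσR
  have hσR'' : (σ : ℝ) ≤ R := hσR.trans (div_le_self hR0 h1.le)
  have h2 := sum_ballProfile_le hn σ hσR' (N := ⌊R⌋₊) (Nat.le_floor hσR'')
  have h3 := intervalIntegral_ballProfile_le hR0 (n := n) (by omega) (⌊R⌋₊.cast_nonneg)
  have h4 := trapezoid_gain_ge hn hR0 hσR''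
  linarith

/-- The estimate of the lattice sum behind the bound in dimensions `d ≥ 11`. -/
lemma sum_le_boundHigh_sub_extraTerm {n : ℕ} (hn : 10 ≤ n) {L : ℝ} (hL : 0 < L) {A : ℝ}
    (hA : 0 ≤ A) {μ : ℝ} (hμ : Real.pi * √((n : ℝ) - 1) / L ≤ μ) :
    unitBallVolume n / (2 * Real.pi) ^ n * A *
      ∑ l ∈ Finset.range ⌊L * μ / Real.pi⌋₊, √(μ ^ 2 - freq L (l + 1) ^ 2) ^ n ≤
      boundHigh (n + 1) (A * L) L μ - extraTerm (n + 1) (A * L) L μ := by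
  have hπ := Real.pi_pos
  have hn3 : 3 ≤ n := by omega
  have h1 : 3 ≤ √((n : ℝ) - 1) := by
    have : (10 : ℝ) ≤ n := by exact_mod_cast hn
    exact Real.le_sqrt_of_sq_le (by linarith)
  have hμ0 : 0 < μ := lt_of_lt_of_le (by positivity) hμ
  obtain ⟨σ, hσe, hσ⟩ := floorSigma_eq (n := n) hL hμ0.le
  have hRs : √((n : ℝ) - 1) ≤ L * μ / Real.pi := by
    rw [le_div_iff₀ hπ]
    rw [div_le_iff₀ hL] at hμ
    linarith
  have hR0 : 0 < L * μ / Real.pi := by positivity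
  have hσR : (σ : ℝ) ≤ L * μ / Real.pi / √((n : ℝ) - 1) := by
    rw [hσ]; exact Nat.floor_le (by positivity)
  have hσR' : (σ : ℝ) * √((n : ℝ) - 1) ≤ L * μ / Real.pi := (le_div_iff₀ (by linarith)).1 hσR
  have hσ1 : L * μ / Real.pi ≤ (σ + 1) * √((n : ℝ) - 1) := by
    rw [← div_le_iff₀ (by linarith), hσ]
    exact (Nat.lt_floor_add_one _).le
  -- R dominates both 3 and 3σ, hence 2/3 · 3 + 1/3 · 3σ = σ + 2. This is where n ≥ 10 and the lower
  -- bound on μ are used.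
  have hσ2 : (σ : ℝ) + 2 ≤ L * μ / Real.pi := by
    have := σ.cast_nonneg (α := ℝ)
    nlinarith
  have hextra : extraTerm (n + 1) (A * L) L μ =
      unitBallVolume n / (2 * Real.pi) ^ n * A * ((Real.pi / L) ^ n *
        (ballProfile (L * μ / Real.pi) n (σ + 2) / 2)) := by
    have e : μ ^ n = (Real.pi / L) ^ n * (L * μ / Real.pi) ^ n := by
      rw [← mul_pow]
      congr 1
      field_simp
    have e2 : Real.pi / (L * μ) * ((σ : ℝ) + 2) = (σ + 2) / (L * μ / Real.pi) := by
      rw [div_div_eq_mul_div]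
      ring
    have hx : 0 ≤ 1 - (((σ : ℝ) + 2) / (L * μ / Real.pi)) ^ 2 := by
      rw [sub_nonneg]
      exact pow_le_one₀ (by positivity) ((div_le_one hR0).2 hσ2)
    -- The real power agrees with the power of the root because the base is nonnegative, by σ + 2 ≤
    -- R.
    have e3 : (1 - (((σ : ℝ) + 2) / (L * μ / Real.pi)) ^ 2) ^ ((((n + 1 : ℕ) : ℝ) - 1) / 2) =
        √(1 - (((σ : ℝ) + 2) / (L * μ / Real.pi)) ^ 2) ^ n := by
      rw [Real.sqrt_eq_rpow, ← Real.rpow_natCast (_ ^ (1 / 2 : ℝ)), ← Real.rpow_mul hx]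
      congr 1
      push_cast
      ring
    rw [extraTerm, hσe, Nat.add_sub_cancel, e2, e3, e, ballProfile_eq_mul_pow hR0]
    field_simp
  rw [hextra, boundHigh_eq hn3 hL A hμ0.le, hσe, ← mul_sub, ← mul_sub]
  refine sum_sqrt_le hL hA μ ?_
  set R := L * μ / Real.pi with hR
  have hσR'' : (σ : ℝ) ≤ R := by linarith
  have h2 := sum_ballProfile_le_midpoint hR0.le hn3 σ hσR' hσ1 (N := ⌊R⌋₊)
    (Nat.le_floor (by push_cast; linarith))
  have h3 := intervalIntegral_ballProfile_le hR0.le (n := n) (by omega)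
    (show (0 : ℝ) ≤ ⌊R⌋₊ + 1 / 2 by positivity)
  have h4 := trapezoid_gain_ge hn3 hR0.le hσR''
  linarith

end

theorem theorem3p2 (d n : ℕ) (hd : 3 ≤ d) (hdn : d = n + 1)
    (D : Set (Rn n)) (hDopen : IsOpen D) (hDbdd : Bornology.IsBounded D)
    (a L : ℝ) (hL : 0 < L)
    (I : Set ℝ) (hI₁ : Set.Ioo a (a + L) ⊆ I) (hI₂ : I ⊆ Set.Icc a (a + L))
    (hPolya : DirichletPolya D)
    (μ : ℝ) (hμ : 0 ≤ μ) :
    (d = 3 →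
      (dirichletCount (interior (productDomain D I)) μ : EReal) ≤
        ((boundThree (volume.real (productDomain D I)) L μ : ℝ) : EReal)) ∧
    (4 ≤ d →
      (dirichletCount (interior (productDomain D I)) μ : EReal) ≤
        ((boundHigh d (volume.real (productDomain D I)) L μ : ℝ) : EReal)) ∧
    (11 ≤ d → Real.pi * √((d : ℝ) - 2) / L ≤ μ →
      (dirichletCount (interior (productDomain D I)) μ : EReal) ≤
        ((boundHigh d (volume.real (productDomain D I)) L μ
          - extraTerm d (volume.real (productDomain D I)) L μ : ℝ) : EReal)) := by
  have hn : n ≠ 0 := by omega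
  have hA : 0 ≤ volume.real D := measureReal_nonneg
  rw [interior_productDomain hDopen hI₁ hI₂, volume_real_productDomain D hL hI₁ hI₂]
  have hmain := hPolya.product_le hn hDopen hDbdd (a := a) hL hμ
  refine ⟨fun h => ?_, fun h => ?_, fun h hμ' => ?_⟩
  · obtain rfl : n = 2 := by omega
    exact hmain.trans (EReal.coe_le_coe_iff.2 (sum_le_boundThree hL hA hμ))
  · subst hdn
    exact hmain.trans (EReal.coe_le_coe_iff.2 (sum_le_boundHigh (by omega) hL hA hμ))
  · subst hdn
    refine hmain.trans (EReal.coe_le_coe_iff.2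
      (sum_le_boundHigh_sub_extraTerm (by omega) hL hA ?_))
    rwa [show (n : ℝ) - 1 = ((n + 1 : ℕ) : ℝ) - 2 by push_cast; ring]
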